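/- Let $M=\{(z,\ell)\in\mathbb{C}^2\times\mathbb{C}P^1 : z\in\ell\}$ be the blow-up of $\mathbb{C}^2$ at the origin, with its standard complex structure, and let $E=\{z=0\}$ be the exceptional divisor, so that $M\setminus E=\mathbb{C}^2\setminus\{0\}$. There is exactly one Kähler metric $g_S$ on $M$ (the Simanca metric) whose Kähler form on $M\setminus E$ is $\frac{i}{2}\partial\bar\partial\left(|z|^2+\log|z|^2\right)$. It has the following properties. 1. It is complete (every Cauchy sequence for the Riemannian distance converges). 2. It is asymptotically locally Euclidean (ALE), of order $2$: there are a finite group $G\subset O(4)$, an $r>0$ and a diffeomorphism from $\{x\in\mathbb{R}^4:|x|>r\}/G$ onto the complement of a compact subset of $M$, such that the pull-back to $\{|x|>r\}$ of the metric has coefficients $\delta_{ab}+\eta_{ab}$ with $|\partial^\alpha\eta_{ab}|\le C_k|x|^{-2-k}$ for all multi-indices $\alpha$ with $|\alpha|=k$ and all $k\ge 0$. 3. It is radial: on $M\setminus E$ it has a Kähler potential that depends only on $|z|^2$. 4. It is projectively induced: there is a holomorphic map $\varphi:M\to\mathbb{C}P^\infty$ with $\varphi^*\omega_{FS}$ equal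 to the Kähler form of $g_S$, where $\mathbb{C}P^\infty$ is the projective space of $\ell^2(\mathbb{C})$ and $\omega_{FS}=\frac{i}{2}\partial\bar\partial\log\sum_j|Z_j|^2$. 5. It is scalar-flat and not Ricci-flat. 6. Its coefficient $a_3$ vanishes identically on $M$, where $a_3$ is Lu's formula for the third coefficient of the Tian--Yau--Zelditch (TYZ) expansion: $$a_3=\tfrac18\Delta\Delta\rho+\tfrac1{24}\mathrm{div}\,\mathrm{div}(R,\mathrm{Ric})-\tfrac16\mathrm{div}\,\mathrm{div}(\rho\,\mathrm{Ric})+\tfrac1{48}\Delta(|R|^2-4|\mathrm{Ric}|^2+8\rho^2)+\tfrac1{48}\rho(\rho^2-4|\mathrm{Ric}|^2+|R|^2)+\tfrac1{24}(\sigma_3(\mathrm{Ric})-\mathrm{Ric}(R,R)-R(\mathrm{Ric},\mathrm{Ric})).$$ The notation in 6 is as follows, in local holomorphic coordinates and summing over repeated indices. The Kähler form is $\frac i2 g_{i\bar j}\,dz_i\wedge d\bar z_j$; $g^{i\bar j}$ is defined by $g^{i\bar j}g_{k\bar j}=\delta_{ik}$; $R_{i\bar jk\bar l}=\partial_k\partial_{\bar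 j}g_{i\bar l}-g^{q\bar p}\partial_kg_{i\bar p}\partial_{\bar j}g_{q\bar l}$; $\mathrm{Ric}_{i\bar j}=-\partial_i\partial_{\bar j}\log\det(g_{k\bar l})$; $\rho=g^{i\bar j}\mathrm{Ric}_{i\bar j}$ is the scalar curvature; $\Delta f=g^{i\bar j}\partial_i\partial_{\bar j}f$; $|R|^2$ and $|\mathrm{Ric}|^2$ are the squared norms with respect to $(g_{i\bar j})$; an index after a comma denotes a covariant derivative; and $$\mathrm{div}\,\mathrm{div}(\rho\,\mathrm{Ric})=2|D'\rho|^2+g^{i\bar b}g^{a\bar j}\mathrm{Ric}_{i\bar j}\partial_a\partial_{\bar b}\rho+\rho\Delta\rho,$$ $$\mathrm{div}\,\mathrm{div}(R,\mathrm{Ric})=-g^{i\bar b}g^{a\bar j}\mathrm{Ric}_{i\bar j}\partial_a\partial_{\bar b}\rho-2|D'\mathrm{Ric}|^2+g^{i\bar a}g^{b\bar j}g^{k\bar c}g^{d\bar l}\mathrm{Ric}_{i\bar j,k\bar l}R_{b\bar ad\bar c}-R(\mathrm{Ric},\mathrm{Ric})-\sigma_3(\mathrm{Ric}),$$ $$|D'\rho|^2=g^{i\bar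 j}\partial_i\rho\,\partial_{\bar j}\rho,\qquad |D'\mathrm{Ric}|^2=g^{i\bar a}g^{b\bar j}g^{k\bar c}\mathrm{Ric}_{i\bar j,k}\overline{\mathrm{Ric}_{a\bar b,c}},$$ $$R(\mathrm{Ric},\mathrm{Ric})=g^{i\bar a}g^{b\bar j}g^{k\bar c}g^{d\bar l}R_{i\bar jk\bar l}\mathrm{Ric}_{b\bar a}\mathrm{Ric}_{d\bar c},\qquad \sigma_3(\mathrm{Ric})=g^{i\bar d}g^{a\bar j}g^{c\bar b}\mathrm{Ric}_{i\bar j}\mathrm{Ric}_{a\bar b}\mathrm{Ric}_{c\bar d},$$ $$\mathrm{Ric}(R,R)=g^{i\bar a}g^{b\bar j}g^{k\bar c}g^{p\bar d}g^{e\bar q}\mathrm{Ric}_{i\bar j}R_{b\bar cp\bar q}R_{k\bar ae\bar d}.$$ -/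

import Mathlib

open scoped Manifold ContDiff LinearAlgebra.Projectivization

noncomputable section

/-- The model space `ℂⁿ` with its standard (Hermitian) norm. -/
abbrev Cn (n : ℕ) : Type := EuclideanSpace ℂ (Fin n)

/-! ### Wirtinger derivatives and curvature of a Hermitian matrix function on an open set of `ℂⁿ` -/

/-- `∂f/∂zᵢ = (∂f/∂xᵢ - √-1 ∂f/∂yᵢ)/2`. -/
def wirt {n : ℕ} (i : Fin n) (f : Cn n → ℂ) (p : Cn n) : ℂ :=
  (1 / 2) * (fderiv ℝ f p (EuclideanSpace.single i 1)
    - Complex.I * fderiv ℝ f p (EuclideanSpace.single i Complex.I))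

/-- `∂f/∂z̄ᵢ = (∂f/∂xᵢ + √-1 ∂f/∂yᵢ)/2`. -/
def wirtBar {n : ℕ} (i : Fin n) (f : Cn n → ℂ) (p : Cn n) : ℂ :=
  (1 / 2) * (fderiv ℝ f p (EuclideanSpace.single i 1)
    + Complex.I * fderiv ℝ f p (EuclideanSpace.single i Complex.I))

/-- The complex Hessian `∂²φ/∂zᵢ∂z̄ⱼ` of a real function. -/
def ddbar {n : ℕ} (φ : Cn n → ℝ) (i j : Fin n) (p : Cn n) : ℂ :=
  wirt i (wirtBar j (fun q => (φ q : ℂ))) p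

/-- The coefficients `g_{i j̄}` of a metric, as functions of the coordinates. -/
abbrev MetricCoeff (n : ℕ) : Type := Fin n → Fin n → Cn n → ℂ

namespace MetricCoeff

variable {n : ℕ} (g : MetricCoeff n)

/-- The matrix `(g_{i j̄})` at a point. -/
def mat (p : Cn n) : Matrix (Fin n) (Fin n) ℂ := Matrix.of fun i j => g i j p

/-- `g^{i j̄}`, the inverse matrix: `∑ⱼ g^{i j̄} g_{k j̄} = δ_{ik}`. -/
def inv (i j : Fin n) (p : Cn n) : ℂ := ((g.mat p)⁻¹) j i

/-- Christoffel symbols `Γ^p_{ki} = g^{p q̄} ∂ₖ g_{i q̄}`. -/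
def christoffel (p k i : Fin n) (x : Cn n) : ℂ :=
  ∑ q, g.inv p q x * wirt k (g i q) x

/-- Curvature `R_{i j̄ k l̄} = ∂ₖ∂_{j̄} g_{i l̄} - g^{q p̄} ∂ₖ g_{i p̄} ∂_{j̄} g_{q l̄}`. -/
def riem (i j k l : Fin n) (x : Cn n) : ℂ :=
  wirt k (wirtBar j (g i l)) x
    - ∑ p, ∑ q, g.inv q p x * wirt k (g i p) x * wirtBar j (g q l) x

/-- Ricci tensor `Ric_{i j̄} = -∂ᵢ∂_{j̄} log det g`
(the determinant of a positive Hermitian matrix is a positive real). -/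
def ric (i j : Fin n) (x : Cn n) : ℂ :=
  -ddbar (fun y => Real.log (g.mat y).det.re) i j x

/-- Scalar curvature `ρ = g^{i j̄} Ric_{i j̄}`. -/
def scal (x : Cn n) : ℂ := ∑ i, ∑ j, g.inv i j x * g.ric i j x

/-- The Laplacian `Δf = g^{i j̄} ∂ᵢ∂_{j̄} f`. -/
def laplacian (f : Cn n → ℂ) (x : Cn n) : ℂ :=
  ∑ i, ∑ j, g.inv i j x * wirt i (wirtBar j f) x

/-- First covariant derivative `Ric_{i j̄, k} = ∂ₖ Ric_{i j̄} - Γ^p_{ki} Ric_{p j̄}`. -/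
def ricD (i j k : Fin n) (x : Cn n) : ℂ :=
  wirt k (g.ric i j) x - ∑ p, g.christoffel p k i x * g.ric p j x

/-- Second covariant derivative
`Ric_{i j̄, k l̄} = ∂_{l̄} (Ric_{i j̄, k}) - conj (Γ^p_{lj}) Ric_{i p̄, k}`. -/
def ricDD (i j k l : Fin n) (x : Cn n) : ℂ :=
  wirtBar l (g.ricD i j k) x - ∑ p, star (g.christoffel p l j x) * g.ricD i p k x

/-- `|R|²`. -/
def normSqRiem (x : Cn n) : ℂ :=
  ∑ i, ∑ j, ∑ k, ∑ l, ∑ a, ∑ b, ∑ c, ∑ d,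
    g.inv i a x * g.inv b j x * g.inv k c x * g.inv d l x
      * g.riem i j k l x * star (g.riem a b c d x)

/-- `|Ric|²`. -/
def normSqRic (x : Cn n) : ℂ :=
  ∑ i, ∑ j, ∑ a, ∑ b, g.inv i a x * g.inv b j x * g.ric i j x * star (g.ric a b x)

/-- `|D'ρ|²`. -/
def normSqDScal (x : Cn n) : ℂ :=
  ∑ i, ∑ j, g.inv i j x * wirt i g.scal x * wirtBar j g.scal x

/-- `|D'Ric|²`. -/
def normSqDRic (x : Cn n) : ℂ :=
  ∑ i, ∑ j, ∑ k, ∑ a, ∑ b, ∑ c,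
    g.inv i a x * g.inv b j x * g.inv k c x * g.ricD i j k x * star (g.ricD a b c x)

/-- The contraction `Ric_{i j̄} ∂_a ∂_{b̄} ρ` (with `i` against `b̄` and `a` against `j̄`). -/
def ricHessScal (x : Cn n) : ℂ :=
  ∑ i, ∑ j, ∑ a, ∑ b,
    g.inv i b x * g.inv a j x * g.ric i j x * wirt a (wirtBar b g.scal) x

/-- `R(Ric, Ric)`. -/
def riemRicRic (x : Cn n) : ℂ :=
  ∑ i, ∑ j, ∑ k, ∑ l, ∑ a, ∑ b, ∑ c, ∑ d,
    g.inv i a x * g.inv b j x * g.inv k c x * g.inv d l x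
      * g.riem i j k l x * g.ric b a x * g.ric d c x

/-- `Ric(R, R)`. -/
def ricRiemRiem (x : Cn n) : ℂ :=
  ∑ i, ∑ j, ∑ k, ∑ a, ∑ b, ∑ c, ∑ d, ∑ p, ∑ q, ∑ e,
    g.inv i a x * g.inv b j x * g.inv k c x * g.inv p d x * g.inv e q x
      * g.ric i j x * g.riem b c p q x * g.riem k a e d x

/-- `σ₃(Ric)`. -/
def sigma3Ric (x : Cn n) : ℂ :=
  ∑ i, ∑ j, ∑ a, ∑ b, ∑ c, ∑ d,
    g.inv i d x * g.inv a j x * g.inv c b x * g.ric i j x * g.ric a b x * g.ric c d x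

/-- The contraction `Ric_{i j̄, k l̄} R_{b ā d c̄}` occurring in `div div (R, Ric)`. -/
def ricDDRiem (x : Cn n) : ℂ :=
  ∑ i, ∑ j, ∑ k, ∑ l, ∑ a, ∑ b, ∑ c, ∑ d,
    g.inv i a x * g.inv b j x * g.inv k c x * g.inv d l x
      * g.ricDD i j k l x * g.riem b a d c x

/-- `div div (ρ Ric)`. -/
def divDivScalRic (x : Cn n) : ℂ :=
  2 * g.normSqDScal x + g.ricHessScal x + g.scal x * g.laplacian g.scal x

/-- `div div (R, Ric)`. -/
def divDivRiemRic (x : Cn n) : ℂ :=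
  -g.ricHessScal x - 2 * g.normSqDRic x + g.ricDDRiem x - g.riemRicRic x - g.sigma3Ric x

/-- Lu's formula for the third Tian-Yau-Zelditch coefficient `a₃`. -/
def tyz3 (x : Cn n) : ℂ :=
  (1 / 8) * g.laplacian (g.laplacian g.scal) x
    + (1 / 24) * g.divDivRiemRic x
    - (1 / 6) * g.divDivScalRic x
    + (1 / 48) * g.laplacian
        (fun y => g.normSqRiem y - 4 * g.normSqRic y + 8 * g.scal y ^ 2) x
    + (1 / 48) * g.scal x * (g.scal x ^ 2 - 4 * g.normSqRic x + g.normSqRiem x)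
    + (1 / 24) * (g.sigma3Ric x - g.ricRiemRiem x - g.riemRicRic x)

end MetricCoeff

/-! ### Kähler metrics on complex manifolds -/

section KahlerMetric

variable {n : ℕ} {M : Type*} [TopologicalSpace M] [ChartedSpace (Cn n) M]

/-- Coefficients `h(∂/∂zᵢ, ∂/∂zⱼ)` of a field `h` of sesquilinear forms in the chart `e`. -/
def hermCoeff
    (h : ∀ x : M, TangentSpace 𝓘(ℂ, Cn n) x →ₗ[ℂ] TangentSpace 𝓘(ℂ, Cn n) x →ₗ⋆[ℂ] ℂ)
    (e : OpenPartialHomeomorph M (Cn n)) : MetricCoeff n := fun i j y =>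
  h (e.symm y)
    (mfderiv 𝓘(ℂ, Cn n) 𝓘(ℂ, Cn n) e.symm y (EuclideanSpace.single i 1 : Cn n))
    (mfderiv 𝓘(ℂ, Cn n) 𝓘(ℂ, Cn n) e.symm y (EuclideanSpace.single j 1 : Cn n))

variable (n M) in
/-- A Kähler metric on the complex manifold `M`: a smooth field of positive definite Hermitian
forms `h = ∑ g_{i j̄} dzᵢ ⊗ dz̄ⱼ` whose fundamental form
`ω = (√-1/2) ∑ g_{i j̄} dzᵢ ∧ dz̄ⱼ` is closed. The Riemannian metric is `Re h`. -/
structure KahlerMetric [IsManifold 𝓘(ℂ, Cn n) ω M] where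
  herm : ∀ x : M, TangentSpace 𝓘(ℂ, Cn n) x →ₗ[ℂ] TangentSpace 𝓘(ℂ, Cn n) x →ₗ⋆[ℂ] ℂ
  herm_symm : ∀ x v w, star (herm x v w) = herm x w v
  herm_pos : ∀ x v, v ≠ 0 → 0 < (herm x v v).re
  smooth : ∀ e ∈ atlas (Cn n) M, ∀ i j, ContDiffOn ℝ ∞ (hermCoeff herm e i j) e.target
  closed : ∀ e ∈ atlas (Cn n) M, ∀ y ∈ e.target, ∀ i j k,
    wirt k (hermCoeff herm e i j) y = wirt i (hermCoeff herm e k j) y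

namespace KahlerMetric

variable [IsManifold 𝓘(ℂ, Cn n) ω M] (g : KahlerMetric n M)

/-- Coefficients `g_{i j̄}` in the chart `e`. -/
def coeff (e : OpenPartialHomeomorph M (Cn n)) : MetricCoeff n := hermCoeff g.herm e

/-- `Φ` is a Kähler potential on the open set `U`: `ω = (√-1/2) ∂∂̄Φ`, i.e.
`g_{i j̄} = ∂²Φ/∂zᵢ∂z̄ⱼ`, on `U`. -/
def IsPotentialOn (Φ : M → ℝ) (U : Set M) : Prop :=
  ContMDiffOn 𝓘(ℝ, Cn n) 𝓘(ℝ) ∞ Φ U ∧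
  ∀ e ∈ atlas (Cn n) M, ∀ y ∈ e.target, e.symm y ∈ U →
    ∀ i j, g.coeff e i j y = ddbar (Φ ∘ e.symm) i j y

/-- The scalar curvature. -/
def scalarCurvature (x : M) : ℂ :=
  (g.coeff (chartAt (Cn n) x)).scal (chartAt (Cn n) x x)

/-- The third Tian-Yau-Zelditch coefficient `a₃`. -/
def a3 (x : M) : ℂ :=
  (g.coeff (chartAt (Cn n) x)).tyz3 (chartAt (Cn n) x x)

def IsScalarFlat : Prop := ∀ x : M, g.scalarCurvature x = 0

def IsRicciFlat : Prop :=
  ∀ x : M, ∀ i j, (g.coeff (chartAt (Cn n) x)).ric i j (chartAt (Cn n) x x) = 0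

/-- The underlying Riemannian metric `Re h`. -/
def riemannian (x : M) (v w : TangentSpace 𝓘(ℝ, Cn n) x) : ℝ := (g.herm x v w).re

/-- The Riemannian distance: infimum of the lengths of `C¹` curves. -/
def riemDist (x y : M) : ENNReal :=
  letI : ∀ x : M, ENorm (TangentSpace 𝓘(ℝ, Cn n) x) :=
    fun x => ⟨fun v => ENNReal.ofReal (Real.sqrt (g.riemannian x v v))⟩
  Manifold.riemannianEDist 𝓘(ℝ, Cn n) x y

/-- Completeness: Cauchy sequences for the Riemannian distance converge. -/
def IsComplete : Prop :=
  ∀ u : ℕ → M,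
    (∀ ε : ENNReal, 0 < ε → ∃ N, ∀ m ≥ N, ∀ k ≥ N, g.riemDist (u m) (u k) < ε) →
    ∃ x, Filter.Tendsto (fun k => g.riemDist (u k) x) Filter.atTop (nhds 0)

/-- Asymptotically locally Euclidean of order `τ`: for a finite group `G` of linear isometries of
`ℝ²ⁿ = ℂⁿ`, there is a diffeomorphism from the quotient by `G` of the exterior of a closed ball
onto the complement of a compact set (given here by the local diffeomorphism `ψ` on the exterior
whose fibres are the `G`-orbits), such that the difference of the pulled back metric and the
Euclidean one is `O(r^{-τ})`, with all `k`-th partial derivatives `O(r^{-τ-k})`. -/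
def IsALEOfOrder (τ : ℝ) : Prop :=
  ∃ (G : Subgroup (Cn n ≃ₗᵢ[ℝ] Cn n)) (r : ℝ) (ψ : Cn n → M),
    Finite G ∧ 0 < r ∧
    ContMDiffOn 𝓘(ℝ, Cn n) 𝓘(ℝ, Cn n) ∞ ψ {x | r < ‖x‖} ∧
    (∀ x, r < ‖x‖ → Function.Injective (mfderiv 𝓘(ℝ, Cn n) 𝓘(ℝ, Cn n) ψ x)) ∧
    (∀ x y, r < ‖x‖ → r < ‖y‖ → (ψ x = ψ y ↔ ∃ γ ∈ G, γ x = y)) ∧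
    IsCompact (ψ '' {x | r < ‖x‖})ᶜ ∧
    ∀ (v w : Cn n) (k : ℕ), ∃ C : ℝ, ∀ x, r < ‖x‖ →
      ‖iteratedFDeriv ℝ k (fun y =>
          g.riemannian (ψ y) (mfderiv 𝓘(ℝ, Cn n) 𝓘(ℝ, Cn n) ψ y v)
            (mfderiv 𝓘(ℝ, Cn n) 𝓘(ℝ, Cn n) ψ y w) - (inner ℂ v w).re) x‖
        ≤ C * ‖x‖ ^ (-τ - (k : ℝ))

/-- The Hilbert space `ℓ²(ℂ)`; its projectivization is `ℂP^∞`. -/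
abbrev EllTwo : Type := lp (fun _ : ℕ => ℂ) 2

/-- `φ : M → ℂP^∞` is a Kähler immersion for the Fubini-Study form `(√-1/2) ∂∂̄ log ∑ |Zⱼ|²`:
near every point it is `[F]` for a nowhere zero holomorphic map `F` to `ℓ²(ℂ)`, and
`log ‖F‖²` is a Kähler potential of `g`. -/
def IsKahlerImmersion (φ : M → ℙ ℂ EllTwo) : Prop :=
  ∀ x : M, ∃ U : Set M, IsOpen U ∧ x ∈ U ∧ ∃ F : M → EllTwo,
    MDifferentiableOn 𝓘(ℂ, Cn n) 𝓘(ℂ, EllTwo) F U ∧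
    (∀ y ∈ U, ∃ hy : F y ≠ 0, φ y = Projectivization.mk ℂ (F y) hy) ∧
    g.IsPotentialOn (fun y => Real.log (‖F y‖ ^ 2)) U

/-- Projectively induced: there is a Kähler immersion into `ℂP^N` for some `N ≤ ∞`; since `ℂP^N` is
a Kähler submanifold of `ℂP^∞`, it is enough to take `N = ∞`. -/
def IsProjectivelyInduced : Prop := ∃ φ : M → ℙ ℂ EllTwo, g.IsKahlerImmersion φ

end KahlerMetric

end KahlerMetric

/-! ### The blow-up of `ℂ²` at the origin -/

/-- The blow-up of `ℂ²` at the origin: pairs `(z, ℓ)` of a point and a line through the origin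
containing it. -/
def BlowUp : Type := {p : Cn 2 × ℙ ℂ (Cn 2) // p.1 ∈ p.2.submodule}

namespace BlowUp

/-- The blow-down map to `ℂ²`, biholomorphic off the exceptional divisor. -/
def blowDown (p : BlowUp) : Cn 2 := p.1.1

/-- The complement of the exceptional divisor. -/
def offE : Set BlowUp := {p | p.blowDown ≠ 0}

/-- The vector with `a`-th coordinate `1` and the other coordinate `v`. -/
def dir (a : Fin 2) (v : ℂ) : Cn 2 :=
  EuclideanSpace.single a 1 + v • EuclideanSpace.single a.rev 1

@[simp] lemma dir_self (a : Fin 2) (v : ℂ) : dir a v a = 1 := by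
  fin_cases a <;> simp [dir, Fin.rev]

@[simp] lemma dir_rev (a : Fin 2) (v : ℂ) : dir a v a.rev = v := by
  fin_cases a <;> simp [dir, Fin.rev]

lemma dir_ne_zero (a : Fin 2) (v : ℂ) : dir a v ≠ 0 := by
  intro h
  have := dir_self a v
  rw [h] at this
  simp at this

lemma ext_rev {x y : Cn 2} (a : Fin 2) (h : x a = y a) (h' : x a.rev = y a.rev) : x = y := by
  ext i
  fin_cases a <;> fin_cases i <;> simp_all [Fin.rev]

/-- A line on which the `a`-th coordinate does not vanish is spanned by `dir a v`, with `v` the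
ratio of coordinates. -/
lemma mk_dir_ratio (a : Fin 2) (l : ℙ ℂ (Cn 2)) (h : l.rep a ≠ 0) :
    Projectivization.mk ℂ (dir a (l.rep a.rev / l.rep a)) (dir_ne_zero _ _) = l := by
  conv_rhs => rw [← l.mk_rep]
  rw [Projectivization.mk_eq_mk_iff']
  refine ⟨(l.rep a)⁻¹, ext_rev a ?_ ?_⟩
  · simp [h]
  · simp [div_eq_inv_mul]

lemma rep_mk (w : Cn 2) (hw : w ≠ 0) :
    ∃ c : ℂ, c ≠ 0 ∧ (Projectivization.mk ℂ w hw).rep = c • w := by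
  obtain ⟨c, hc⟩ := Projectivization.exists_smul_eq_mk_rep ℂ w hw
  exact ⟨c, c.ne_zero, hc.symm⟩

/-- The standard coordinates on the blow-up: `(z, ℓ) ↦ (u, v)` with `u = z_a` and
`v` the slope `ℓ_b / ℓ_a`, where `b` is the index other than `a`; its inverse is
`z_a = u`, `z_b = u v`, `ℓ = [z_a : z_b] = [1 : v]`. -/
def chart (a : Fin 2) : PartialEquiv BlowUp (Cn 2) where
  toFun p := !₂[p.1.1 a, p.1.2.rep a.rev / p.1.2.rep a]
  invFun y := ⟨(y 0 • dir a (y 1), Projectivization.mk ℂ (dir a (y 1)) (dir_ne_zero _ _)), by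
    rw [Projectivization.submodule_mk]
    exact Submodule.smul_mem _ _ (Submodule.mem_span_singleton_self _)⟩
  source := {p | p.1.2.rep a ≠ 0}
  target := Set.univ
  map_source' _ _ := Set.mem_univ _
  map_target' y _ := by
    obtain ⟨c, hc, h⟩ := rep_mk (dir a (y 1)) (dir_ne_zero _ _)
    change (Projectivization.mk ℂ (dir a (y 1)) (dir_ne_zero _ _)).rep a ≠ 0
    simp [h, hc]
  left_inv' := by
    rintro ⟨⟨z, l⟩, hz⟩ h
    have h' : l.rep a ≠ 0 := h
    apply Subtype.ext
    refine Prod.ext ?_ (mk_dir_ratio a l h')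
    have hz' : z ∈ l.submodule := hz
    rw [Projectivization.submodule_eq] at hz'
    obtain ⟨c, rfl⟩ := Submodule.mem_span_singleton.1 hz'
    apply ext_rev a
    · simp
    · simp
      field_simp
  right_inv' y _ := by
    obtain ⟨c, hc, h⟩ := rep_mk (dir a (y 1)) (dir_ne_zero _ _)
    ext i
    fin_cases i
    · simp
    · simp [h, hc]

/-- The transition maps are the identity or `(u, v) ↦ (u v, 1 / v)`. -/
lemma chart_symm_trans (a b : Fin 2) (y : Cn 2) :
    (chart a).symm.trans (chart b) y =
      !₂[y 0 * dir a (y 1) b, dir a (y 1) b.rev / dir a (y 1) b] := by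
  obtain ⟨c, hc, h⟩ := rep_mk (dir a (y 1)) (dir_ne_zero _ _)
  change !₂[(y 0 • dir a (y 1)) b,
    (Projectivization.mk ℂ (dir a (y 1)) (dir_ne_zero _ _)).rep b.rev /
      (Projectivization.mk ℂ (dir a (y 1)) (dir_ne_zero _ _)).rep b] = _
  rw [h]
  ext i
  fin_cases i
  · simp
  · simp [hc, mul_div_mul_left]

lemma chart_symm_trans_source (a b : Fin 2) :
    ((chart a).symm.trans (chart b)).source = {y | dir a (y 1) b ≠ 0} := by
  ext y
  obtain ⟨c, hc, h⟩ := rep_mk (dir a (y 1)) (dir_ne_zero _ _)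
  rw [PartialEquiv.trans_source]
  change True ∧ (Projectivization.mk ℂ (dir a (y 1)) (dir_ne_zero _ _)).rep b ≠ 0 ↔ _
  rw [h]
  simp [hc]

lemma contDiff_dir (a b : Fin 2) : ContDiff ℂ ω (fun y : Cn 2 => dir a (y 1) b) := by
  unfold dir
  simp only [PiLp.add_apply, PiLp.smul_apply]
  fun_prop

lemma contDiffOn_transition (a b : Fin 2) :
    ContDiffOn ℂ ω ((chart a).symm.trans (chart b))
      ((chart a).symm.trans (chart b)).source := by
  rw [chart_symm_trans_source]
  refine ContDiffOn.congr ?_ (fun y _ => chart_symm_trans a b y)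
  rw [contDiffOn_euclidean]
  intro i
  fin_cases i
  · simp only [Fin.zero_eta, Matrix.cons_val_zero]
    have := contDiff_dir a b
    fun_prop
  · simp only [Fin.mk_one, Matrix.cons_val_one]
    exact (contDiff_dir a b.rev).contDiffOn.div (contDiff_dir a b).contDiffOn (fun y hy => hy)

lemma rep_one_ne_zero (p : BlowUp) (h : ¬ p.1.2.rep 0 ≠ 0) : p.1.2.rep 1 ≠ 0 := by
  intro h1
  apply p.1.2.rep_nonzero
  ext i
  fin_cases i
  · simpa using h
  · simpa using h1

open Classical in
/-- The complex structure of the blow-up, given by the two standard coordinate systems. -/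
def core : ChartedSpaceCore (Cn 2) BlowUp where
  atlas := Set.range chart
  chartAt p := if p.1.2.rep 0 ≠ 0 then chart 0 else chart 1
  mem_chart_source p := by
    split_ifs with h
    · exact h
    · exact rep_one_ne_zero p h
  chart_mem_atlas p := by
    split_ifs
    · exact ⟨0, rfl⟩
    · exact ⟨1, rfl⟩
  open_source := by
    rintro _ _ ⟨a, rfl⟩ ⟨b, rfl⟩
    rw [chart_symm_trans_source]
    exact isOpen_ne_fun (contDiff_dir a b).continuous continuous_const
  continuousOn_toFun := by
    rintro _ _ ⟨a, rfl⟩ ⟨b, rfl⟩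
    exact (contDiffOn_transition a b).continuousOn

instance : TopologicalSpace BlowUp := core.toTopologicalSpace

instance : ChartedSpace (Cn 2) BlowUp := core.toChartedSpace

instance : IsManifold 𝓘(ℂ, Cn 2) ω BlowUp := by
  apply isManifold_of_contDiffOn
  rintro _ _ ⟨s, ⟨e, rfl⟩, hs⟩ ⟨s', ⟨e', rfl⟩, hs'⟩
  simp only [Set.mem_iUnion] at hs hs'
  obtain ⟨⟨a, rfl⟩, hs⟩ := hs
  obtain ⟨⟨b, rfl⟩, hs'⟩ := hs'
  rw [Set.mem_singleton_iff] at hs hs'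
  subst hs hs'
  simpa using! contDiffOn_transition a b

/-- The function `f(|z|²)` on the blow-up. -/
def radial (f : ℝ → ℝ) (p : BlowUp) : ℝ := f (‖p.blowDown‖ ^ 2)

/-- A radial metric: off the exceptional divisor it has a Kähler potential that depends only
on `|z|²`. -/
def IsRadial (g : KahlerMetric 2 BlowUp) : Prop :=
  ∃ f : ℝ → ℝ, g.IsPotentialOn (radial f) offE

/-- The Simanca metric: off the exceptional divisor it has the Kähler potential
`|z|² + log |z|²`. -/
def IsSimanca (g : KahlerMetric 2 BlowUp) : Prop :=
  g.IsPotentialOn (radial fun x => x + Real.log x) offE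

end BlowUp

end

/-! In a standard chart `(u, v)` one has `|z|² = |u|² (1 + |v|²)`, so off the exceptional divisor
the potential equals `pot = |u|² (1 + |v|²) + log (1 + |v|²)` plus `log |u|²`, and the last term is
pluriharmonic. Hence the complex Hessian extends across the divisor as the smooth matrix `G`: the
flat metric pulled back by the blow-down, plus the Fubini-Study metric in `v`. It is positive
(`form_pos`) and compatible with the change of chart (`form_transition`); since the divisor has
dense complement, it is the only extension (`IsSimanca.coeff_eq`).

Curvature. Put `a = 1/(1 + |v|²)`, `b = 1/(1 + |z|²)`, `s = |z|²`; then `det G = a / b`. In a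
coframe that diagonalizes the metric, the curvature with its barred indices raised is `b²` times a
constant tensor (`riemM_G`), and the Ricci endomorphism has eigenvalues `b²` and `-b²` (`ricM_G`).
So `ρ = 0` and `|R|² = 8 b⁴ = 4 |Ric|²`. The terms of `a₃` that survive are `|D'Ric|²`, the
contraction of the second derivative of `Ric` with `R`, `R(Ric, Ric)` and `Ric(R, R)`, equal to `12
s`, `24 s - 4`, `-4` and `4` times `b⁶`; they cancel (`tyz3_G`).

Global properties. The blow-down does not increase lengths and has compact fibres over bounded sets,
which gives completeness (`isComplete_simanca`). Off the divisor the metric is the Euclidean one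
plus `|z ∧ dz|² / |z|⁴`, whose coefficients are homogeneous of degree `-2`; this is the ALE decay
(`isALE_simanca`). Finally `exp pot = ‖(1, v)‖² exp |z|²` is the squared norm of `(1, v) ⊗ e(z)`,
with `e(z)` the coherent state in the Bargmann-Fock space, so `(z, [w]) ↦ [w ⊗ e(z)]` is a Kähler
immersion (`isProjectivelyInduced_simanca`). -/

noncomputable section

/-! ### Calculus of Wirtinger derivatives -/

section Wirtinger

variable {n : ℕ} {f g : Cn n → ℂ} {x : Cn n} (i : Fin n)

lemma wirt_const (c : ℂ) : wirt i (fun _ : Cn n => c) x = 0 := by simp [wirt]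

lemma wirtBar_const (c : ℂ) : wirtBar i (fun _ : Cn n => c) x = 0 := by simp [wirtBar]

lemma wirt_fun_add (hf : DifferentiableAt ℝ f x) (hg : DifferentiableAt ℝ g x) :
    wirt i (fun y => f y + g y) x = wirt i f x + wirt i g x := by
  simp only [wirt, fderiv_fun_add hf hg, add_apply]; ring

lemma wirtBar_fun_add (hf : DifferentiableAt ℝ f x) (hg : DifferentiableAt ℝ g x) :
    wirtBar i (fun y => f y + g y) x = wirtBar i f x + wirtBar i g x := by
  simp only [wirtBar, fderiv_fun_add hf hg, add_apply]; ring

lemma wirt_fun_mul (hf : DifferentiableAt ℝ f x) (hg : DifferentiableAt ℝ g x) :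
    wirt i (fun y => f y * g y) x = wirt i f x * g x + f x * wirt i g x := by
  simp only [wirt, fderiv_fun_mul hf hg, add_apply, smul_apply, smul_eq_mul]
  ring

lemma wirtBar_fun_mul (hf : DifferentiableAt ℝ f x) (hg : DifferentiableAt ℝ g x) :
    wirtBar i (fun y => f y * g y) x = wirtBar i f x * g x + f x * wirtBar i g x := by
  simp only [wirtBar, fderiv_fun_mul hf hg, add_apply, smul_apply, smul_eq_mul]
  ring

lemma wirt_fun_neg : wirt i (fun y => -f y) x = -wirt i f x := by
  simp only [wirt, fderiv_fun_neg, neg_apply]; ring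

lemma wirtBar_fun_neg : wirtBar i (fun y => -f y) x = -wirtBar i f x := by
  simp only [wirtBar, fderiv_fun_neg, neg_apply]; ring

lemma wirt_fun_pow (hf : DifferentiableAt ℝ f x) (m : ℕ) :
    wirt i (fun y => f y ^ m) x = m * f x ^ (m - 1) * wirt i f x := by
  simp only [wirt, fderiv_fun_pow m hf, smul_apply, smul_eq_mul, nsmul_eq_mul]
  ring

lemma wirtBar_fun_pow (hf : DifferentiableAt ℝ f x) (m : ℕ) :
    wirtBar i (fun y => f y ^ m) x = m * f x ^ (m - 1) * wirtBar i f x := by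
  simp only [wirtBar, fderiv_fun_pow m hf, smul_apply, smul_eq_mul, nsmul_eq_mul]
  ring

lemma wirt_fun_star (hf : DifferentiableAt ℝ f x) :
    wirt i (fun y => star (f y)) x = star (wirtBar i f x) := by
  simp only [wirt, wirtBar, hf.hasFDerivAt.star.fderiv, ContinuousLinearMap.comp_apply]
  simp
  ring

lemma wirtBar_fun_star (hf : DifferentiableAt ℝ f x) :
    wirtBar i (fun y => star (f y)) x = star (wirt i f x) := by
  simp only [wirt, wirtBar, hf.hasFDerivAt.star.fderiv, ContinuousLinearMap.comp_apply]
  simp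

lemma wirt_coord (k : Fin n) : wirt i (fun y : Cn n => y k) x = if k = i then 1 else 0 := by
  have h : fderiv ℝ (fun y : Cn n => y k) x = (EuclideanSpace.proj k : Cn n →L[ℂ] ℂ).restrictScalars ℝ :=
    ((EuclideanSpace.proj k : Cn n →L[ℂ] ℂ).restrictScalars ℝ).fderiv
  simp only [wirt, h]
  by_cases hk : k = i
  · simp [hk]
    norm_num
  · simp [hk]

lemma wirtBar_coord (k : Fin n) : wirtBar i (fun y : Cn n => y k) x = 0 := by
  have h : fderiv ℝ (fun y : Cn n => y k) x = (EuclideanSpace.proj k : Cn n →L[ℂ] ℂ).restrictScalars ℝ :=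
    ((EuclideanSpace.proj k : Cn n →L[ℂ] ℂ).restrictScalars ℝ).fderiv
  simp only [wirtBar, h]
  by_cases hk : k = i <;> simp [hk]

lemma fderiv_fun_inv_apply (hf : DifferentiableAt ℝ f x) (h0 : f x ≠ 0) (v : Cn n) :
    fderiv ℝ (fun y => (f y)⁻¹) x v = -(fderiv ℝ f x v * (f x)⁻¹ ^ 2) := by
  have h := (hasStrictDerivAt_inv h0).hasDerivAt.hasFDerivAt.restrictScalars ℝ
  have h' := h.comp x hf.hasFDerivAt
  change fderiv ℝ ((fun z => z⁻¹) ∘ f) x v = _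
  rw [h'.fderiv]
  simp

/-- Written as a polynomial in `(f x)⁻¹`, so that all derivatives of `ca` and `cb` remain
polynomials in the coordinates, `ca` and `cb`. -/
lemma wirt_fun_inv (hf : DifferentiableAt ℝ f x) (h0 : f x ≠ 0) :
    wirt i (fun y => (f y)⁻¹) x = -(wirt i f x * (f x)⁻¹ ^ 2) := by
  simp only [wirt, fderiv_fun_inv_apply hf h0]; ring

lemma wirtBar_fun_inv (hf : DifferentiableAt ℝ f x) (h0 : f x ≠ 0) :
    wirtBar i (fun y => (f y)⁻¹) x = -(wirtBar i f x * (f x)⁻¹ ^ 2) := by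
  simp only [wirtBar, fderiv_fun_inv_apply hf h0]; ring

lemma fderiv_ofReal_log_apply {φ : Cn n → ℝ} (hf : DifferentiableAt ℝ φ x) (h0 : φ x ≠ 0)
    (v : Cn n) :
    fderiv ℝ (fun y => (Real.log (φ y) : ℂ)) x v
      = (φ x : ℂ)⁻¹ * fderiv ℝ (fun y => (φ y : ℂ)) x v := by
  have h1 := Complex.ofRealCLM.hasFDerivAt.comp x (hf.hasFDerivAt.log h0)
  have h2 := Complex.ofRealCLM.hasFDerivAt.comp x hf.hasFDerivAt
  change fderiv ℝ (Complex.ofRealCLM ∘ fun y => Real.log (φ y)) x v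
    = _ * fderiv ℝ (Complex.ofRealCLM ∘ φ) x v
  rw [h1.fderiv, h2.fderiv]
  simp

lemma wirtBar_ofReal_log {φ : Cn n → ℝ} (hf : DifferentiableAt ℝ φ x) (h0 : φ x ≠ 0) :
    wirtBar i (fun y => (Real.log (φ y) : ℂ)) x
      = (φ x : ℂ)⁻¹ * wirtBar i (fun y => (φ y : ℂ)) x := by
  simp only [wirtBar, fderiv_ofReal_log_apply hf h0]; ring

open Filter Topology in
lemma wirt_congr (h : f =ᶠ[𝓝 x] g) : wirt i f x = wirt i g x := by
  simp only [wirt, h.fderiv_eq]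

open Filter Topology in
lemma wirtBar_congr (h : f =ᶠ[𝓝 x] g) : wirtBar i f x = wirtBar i g x := by
  simp only [wirtBar, h.fderiv_eq]

end Wirtinger

/-! ### The Simanca metric in the standard coordinates `(u, v)` of the blow-up -/

namespace Simanca

def cu (y : Cn 2) : ℂ := y 0
def cub (y : Cn 2) : ℂ := star (y 0)
def cv (y : Cn 2) : ℂ := y 1
def cvb (y : Cn 2) : ℂ := star (y 1)
/-- `1 / (1 + |v|²)` -/
def ca (y : Cn 2) : ℂ := (1 + cv y * cvb y)⁻¹
/-- `1 / (1 + |u|² (1 + |v|²))` -/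
def cb (y : Cn 2) : ℂ := (1 + cu y * cub y * (1 + cv y * cvb y))⁻¹

lemma cv_mul_cvb (y : Cn 2) : cv y * cvb y = ((‖y 1‖ ^ 2 : ℝ) : ℂ) := by
  simp [cv, cvb, Complex.mul_conj, Complex.normSq_eq_norm_sq]

lemma cu_mul_cub (y : Cn 2) : cu y * cub y = ((‖y 0‖ ^ 2 : ℝ) : ℂ) := by
  simp [cu, cub, Complex.mul_conj, Complex.normSq_eq_norm_sq]

lemma one_add_cv_ne (y : Cn 2) : 1 + cv y * cvb y ≠ 0 := by
  rw [cv_mul_cvb, ← Complex.ofReal_one, ← Complex.ofReal_add, Complex.ofReal_ne_zero]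
  positivity

lemma one_add_cu_ne (y : Cn 2) : 1 + cu y * cub y * (1 + cv y * cvb y) ≠ 0 := by
  rw [cv_mul_cvb, cu_mul_cub, ← Complex.ofReal_one, ← Complex.ofReal_add, ← Complex.ofReal_mul,
    ← Complex.ofReal_add, Complex.ofReal_ne_zero]
  positivity

@[fun_prop] lemma differentiable_cu : Differentiable ℝ cu := by unfold cu; fun_prop
@[fun_prop] lemma differentiable_cub : Differentiable ℝ cub := by unfold cub; fun_prop
@[fun_prop] lemma differentiable_cv : Differentiable ℝ cv := by unfold cv; fun_prop
@[fun_prop] lemma differentiable_cvb : Differentiable ℝ cvb := by unfold cvb; fun_prop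
@[fun_prop] lemma differentiable_ca : Differentiable ℝ ca := by
  unfold ca
  have := one_add_cv_ne
  fun_prop (disch := assumption)
@[fun_prop] lemma differentiable_cb : Differentiable ℝ cb := by
  unfold cb
  have := one_add_cu_ne
  fun_prop (disch := assumption)

variable (x : Cn 2) (k : Fin 2)

lemma wirt_cu : wirt k cu x = if k = 0 then 1 else 0 := by
  simp only [show cu = fun y => y 0 from rfl, wirt_coord, eq_comm]
lemma wirt_cv : wirt k cv x = if k = 1 then 1 else 0 := by
  simp only [show cv = fun y => y 1 from rfl, wirt_coord, eq_comm]
lemma wirtBar_cu : wirtBar k cu x = 0 := wirtBar_coord k 0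
lemma wirtBar_cv : wirtBar k cv x = 0 := wirtBar_coord k 1
lemma wirt_cub : wirt k cub x = 0 := by
  rw [show cub = fun y => star (cu y) from rfl, wirt_fun_star _ (by fun_prop), wirtBar_cu, star_zero]
lemma wirt_cvb : wirt k cvb x = 0 := by
  rw [show cvb = fun y => star (cv y) from rfl, wirt_fun_star _ (by fun_prop), wirtBar_cv, star_zero]
lemma wirtBar_cub : wirtBar k cub x = if k = 0 then 1 else 0 := by
  rw [show cub = fun y => star (cu y) from rfl, wirtBar_fun_star _ (by fun_prop), wirt_cu]
  split_ifs <;> simp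
lemma wirtBar_cvb : wirtBar k cvb x = if k = 1 then 1 else 0 := by
  rw [show cvb = fun y => star (cv y) from rfl, wirtBar_fun_star _ (by fun_prop), wirt_cv]
  split_ifs <;> simp

lemma wirt_ca : wirt k ca x = if k = 1 then -(cvb x * ca x ^ 2) else 0 := by
  rw [show ca = fun y => (1 + cv y * cvb y)⁻¹ from rfl,
    wirt_fun_inv _ (by fun_prop) (one_add_cv_ne x), wirt_fun_add _ (by fun_prop) (by fun_prop),
    wirt_fun_mul _ (by fun_prop) (by fun_prop), wirt_const, wirt_cv, wirt_cvb]
  split_ifs <;> simp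

lemma wirtBar_ca : wirtBar k ca x = if k = 1 then -(cv x * ca x ^ 2) else 0 := by
  rw [show ca = fun y => (1 + cv y * cvb y)⁻¹ from rfl,
    wirtBar_fun_inv _ (by fun_prop) (one_add_cv_ne x), wirtBar_fun_add _ (by fun_prop) (by fun_prop),
    wirtBar_fun_mul _ (by fun_prop) (by fun_prop), wirtBar_const, wirtBar_cv, wirtBar_cvb]
  split_ifs <;> simp

lemma wirt_cb : wirt k cb x = if k = 0 then -(cub x * (1 + cv x * cvb x) * cb x ^ 2)
    else -(cu x * cub x * cvb x * cb x ^ 2) := by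
  rw [show cb = fun y => (1 + cu y * cub y * (1 + cv y * cvb y))⁻¹ from rfl,
    wirt_fun_inv _ (by fun_prop) (one_add_cu_ne x), wirt_fun_add _ (by fun_prop) (by fun_prop),
    wirt_fun_mul _ (by fun_prop) (by fun_prop), wirt_fun_mul _ (by fun_prop) (by fun_prop),
    wirt_fun_add _ (by fun_prop) (by fun_prop), wirt_fun_mul _ (by fun_prop) (by fun_prop)]
  simp only [wirt_const, wirt_cv, wirt_cvb, wirt_cu, wirt_cub]
  fin_cases k <;> simp

lemma wirtBar_cb : wirtBar k cb x = if k = 0 then -(cu x * (1 + cv x * cvb x) * cb x ^ 2)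
    else -(cu x * cub x * cv x * cb x ^ 2) := by
  rw [show cb = fun y => (1 + cu y * cub y * (1 + cv y * cvb y))⁻¹ from rfl,
    wirtBar_fun_inv _ (by fun_prop) (one_add_cu_ne x),
    wirtBar_fun_add _ (by fun_prop) (by fun_prop),
    wirtBar_fun_mul _ (by fun_prop) (by fun_prop), wirtBar_fun_mul _ (by fun_prop) (by fun_prop),
    wirtBar_fun_add _ (by fun_prop) (by fun_prop), wirtBar_fun_mul _ (by fun_prop) (by fun_prop)]
  simp only [wirtBar_const, wirtBar_cv, wirtBar_cvb, wirtBar_cu, wirtBar_cub]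
  fin_cases k <;> simp

lemma star_cu : star (cu x) = cub x := rfl
lemma star_cub : star (cub x) = cu x := by simp [cu, cub]
lemma star_cv : star (cv x) = cvb x := rfl
lemma star_cvb : star (cvb x) = cv x := by simp [cv, cvb]
lemma star_ca : star (ca x) = ca x := by
  simp only [ca, star_inv₀, star_add, star_mul', star_one, star_cv, star_cvb]; ring
lemma star_cb : star (cb x) = cb x := by
  simp only [cb, star_inv₀, star_add, star_mul', star_one, star_cv, star_cvb, star_cu, star_cub]
  ring

end Simanca

/-! ### Metric coefficients, Christoffel symbols and curvature tensor in a chart. -/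

namespace Simanca

/-- The coefficients of the Simanca metric in the standard coordinates. -/
def G : MetricCoeff 2 :=
  ![![fun y => 1 + cv y * cvb y, fun y => cub y * cv y],
    ![fun y => cu y * cvb y, fun y => cu y * cub y + ca y ^ 2]]

variable (x : Cn 2)

lemma wirt_G (i j k : Fin 2) : wirt k (G i j) x =
    ![![![0, cvb x], ![0, cub x]], ![![cvb x, 0], ![cub x, -(2 * cvb x * ca x ^ 3)]]] i j k := by
  fin_cases i <;> fin_cases j <;> fin_cases k <;>
  simp (disch := fun_prop) [G, wirt_fun_add, wirt_fun_mul, wirt_fun_pow, wirt_const, wirt_cu,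
    wirt_cub, wirt_cv, wirt_cvb, wirt_ca]
  ring

lemma wirtBar_G (i j k : Fin 2) : wirtBar k (G i j) x =
    ![![![0, cv x], ![cv x, 0]], ![![0, cu x], ![cu x, -(2 * cv x * ca x ^ 3)]]] i j k := by
  fin_cases i <;> fin_cases j <;> fin_cases k <;>
  simp (disch := fun_prop) [G, wirtBar_fun_add, wirtBar_fun_mul, wirtBar_fun_pow, wirtBar_const,
    wirtBar_cu, wirtBar_cub, wirtBar_cv, wirtBar_cvb, wirtBar_ca]
  ring

lemma det_G : (G.mat x).det = (cb x)⁻¹ * ca x := by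
  have hA := one_add_cv_ne x
  simp only [MetricCoeff.mat, G, Matrix.det_fin_two, Matrix.of_apply, Matrix.cons_val_zero,
    Matrix.cons_val_one, ca, cb]
  field_simp
  ring

lemma ca_ne : ca x ≠ 0 := inv_ne_zero (one_add_cv_ne x)
lemma cb_ne : cb x ≠ 0 := inv_ne_zero (one_add_cu_ne x)

/-- Makes the two denominators opaque nonzero numbers: `field_simp` clears `A` and `B` as atoms, and
only afterwards are they expanded for `ring`. -/
lemma exists_ca_cb : ∃ A B : ℂ, A ≠ 0 ∧ B ≠ 0 ∧ A = 1 + cv x * cvb x ∧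
    B = 1 + cu x * cub x * (1 + cv x * cvb x) ∧ ca x = A⁻¹ ∧ cb x = B⁻¹ :=
  ⟨_, _, one_add_cv_ne x, one_add_cu_ne x, rfl, rfl, rfl, rfl⟩

lemma inv_G (i j : Fin 2) : G.inv i j x =
    ![![ca x + cu x * cub x * cv x * cvb x * cb x, -(cu x * cvb x * (1 + cv x * cvb x) * cb x)],
      ![-(cub x * cv x * (1 + cv x * cvb x) * cb x), (1 + cv x * cvb x) ^ 2 * cb x]] i j := by
  obtain ⟨A, B, hA, hB, eA, eB, ha, hb⟩ := exists_ca_cb x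
  rw [MetricCoeff.inv, Matrix.inv_def, det_G, Ring.inverse_eq_inv']
  fin_cases i <;> fin_cases j <;>
  simp [MetricCoeff.mat, G, Matrix.adjugate_fin_two, ha, hb] <;>
  field_simp <;> simp only [eA, eB] <;> ring

lemma christoffel_G (p k i : Fin 2) : G.christoffel p k i x =
    ![![![0, ca x * cvb x - cu x * cub x * cvb x * cb x],
        ![ca x * cvb x - cu x * cub x * cvb x * cb x, 2 * cu x * cvb x ^ 2 * ca x ^ 2 * cb x]],
      ![![0, cub x * (1 + cv x * cvb x) * cb x],
        ![cub x * (1 + cv x * cvb x) * cb x, -(2 * cvb x * ca x * cb x)]]] p k i := by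
  obtain ⟨A, B, hA, hB, eA, eB, ha, hb⟩ := exists_ca_cb x
  simp only [MetricCoeff.christoffel, Fin.sum_univ_two, inv_G, wirt_G]
  fin_cases p <;> fin_cases k <;> fin_cases i <;> simp [ha, hb] <;>
  (try field_simp) <;> (try simp only [eA, eB]) <;> ring

/-- The coframe `θ⁰ = du + w dv`, `θ¹ = dv`, in which the metric is diagonal. -/
def coframe (y : Cn 2) : Fin 2 → Fin 2 → ℂ := ![![1, cu y * cvb y * ca y], ![0, 1]]

def coframeBar (y : Cn 2) : Fin 2 → Fin 2 → ℂ := ![![1, cub y * cv y * ca y], ![0, 1]]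

/-- The tensor of type `(2, 2)` with the given six components in the coframe. -/
def frameTensor (y : Cn 2) (c0000 c0011 c0110 c1111 : ℂ) (i j k l : Fin 2) : ℂ :=
  let t := coframe y
  let s := coframeBar y
  c0000 * t 0 i * s 0 j * t 0 k * s 0 l
    + c0011 * (t 0 i * s 0 j * t 1 k * s 1 l + t 1 i * s 0 j * t 0 k * s 1 l)
    + c0110 * (t 0 i * s 1 j * t 1 k * s 0 l + t 1 i * s 1 j * t 0 k * s 0 l)
    + c1111 * t 1 i * s 1 j * t 1 k * s 1 l

lemma wirtBar_G_eq (i j k : Fin 2) : wirtBar k (G i j) =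
    ![![![fun _ => 0, cv], ![cv, fun _ => 0]],
      ![![fun _ => 0, cu], ![cu, fun x => -(2 * cv x * ca x ^ 3)]]] i j k := by
  ext x
  rw [wirtBar_G]
  fin_cases i <;> fin_cases j <;> fin_cases k <;> rfl

/-- The stabilizer in `U(2)` of a nonzero `z` fixes `θ⁰` and rotates `θ¹`, so only components with
as many barred as unbarred indices `1` can survive; `frameTensor` has room for exactly these. -/
lemma riem_G (i j k l : Fin 2) : G.riem i j k l x =
    frameTensor x 0 (ca x * cb x) (ca x * cb x) (-2 * ca x ^ 4) i j k l := by
  obtain ⟨A, B, hA, hB, eA, eB, ha, hb⟩ := exists_ca_cb x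
  simp only [MetricCoeff.riem, Fin.sum_univ_two, inv_G, wirt_G, wirtBar_G_eq]
  fin_cases i <;> fin_cases j <;> fin_cases k <;> fin_cases l <;>
  simp (disch := fun_prop) [frameTensor, coframe, coframeBar, wirt_fun_neg, wirt_fun_mul,
    wirt_fun_pow, wirt_const, wirt_cu, wirt_cv, wirt_ca] <;>
  (try simp only [ha, hb]) <;> (try field_simp) <;> (try simp only [eA, eB]) <;> ring

end Simanca

/-! ### Ricci tensor, scalar curvature and covariant derivatives of the Ricci tensor. -/

namespace Simanca

variable (x : Cn 2)

/-- `ric` is defined through the real part of the determinant; nothing is lost, because the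
determinant is its own conjugate. -/
lemma ofReal_re_det_G : (((G.mat x).det.re : ℝ) : ℂ)
    = (1 + cu x * cub x * (1 + cv x * cvb x)) * ca x := by
  have h : star ((cb x)⁻¹ * ca x) = (cb x)⁻¹ * ca x := by
    rw [star_mul', star_inv₀, star_cb, star_ca]
  rw [det_G, Complex.conj_eq_iff_re.1 h, cb, inv_inv]

lemma wirtBar_log_det_G (j : Fin 2) :
    wirtBar j (fun q => (Real.log (G.mat q).det.re : ℂ)) =
      ![fun y => cu y * (1 + cv y * cvb y) * cb y,
        fun y => cu y * cub y * cv y * cb y + -(cv y * ca y)] j := by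
  ext x
  obtain ⟨A, B, hA, hB, eA, eB, ha, hb⟩ := exists_ca_cb x
  have hd : DifferentiableAt ℝ (fun q => (G.mat q).det.re) x := by
    simp only [det_G, cb, inv_inv]
    have h : DifferentiableAt ℝ
      (fun q => (1 + cu q * cub q * (1 + cv q * cvb q)) * ca q) x := by fun_prop
    exact Complex.reCLM.differentiableAt.comp x h
  have h0 : ((G.mat x).det.re : ℂ) ≠ 0 := by
    rw [ofReal_re_det_G]
    exact mul_ne_zero (one_add_cu_ne x) (ca_ne x)
  rw [wirtBar_ofReal_log j hd (by exact_mod_cast h0)]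
  simp only [ofReal_re_det_G]
  fin_cases j <;>
  simp (disch := fun_prop) [wirtBar_fun_add, wirtBar_fun_mul, wirtBar_const,
    wirtBar_cu, wirtBar_cub, wirtBar_cv, wirtBar_cvb, wirtBar_ca] <;>
  simp only [ha, hb, ← eA] <;> rw [← eA] at eB <;> simp only [← eB] <;>
  field_simp

/-- `Ric = -b² g + 2 a² b dv ⊗ dv̄`. -/
lemma ric_G (i j : Fin 2) : G.ric i j =
    ![![fun y => -((1 + cv y * cvb y) * cb y ^ 2), fun y => -(cub y * cv y * cb y ^ 2)],
      ![fun y => -(cu y * cvb y * cb y ^ 2),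
        fun y => 2 * ca y ^ 2 * cb y + -((cu y * cub y + ca y ^ 2) * cb y ^ 2)]] i j := by
  ext x
  obtain ⟨A, B, hA, hB, eA, eB, ha, hb⟩ := exists_ca_cb x
  simp only [MetricCoeff.ric, ddbar, wirtBar_log_det_G]
  fin_cases i <;> fin_cases j <;>
  simp (disch := fun_prop) [wirt_fun_add, wirt_fun_mul, wirt_fun_neg, wirt_const,
    wirt_cu, wirt_cub, wirt_cv, wirt_cvb, wirt_ca, wirt_cb] <;>
  simp only [ha, hb] <;> field_simp <;> simp only [eA, eB] <;> ring

lemma scal_G : G.scal = fun _ => 0 := by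
  ext x
  obtain ⟨A, B, hA, hB, eA, eB, ha, hb⟩ := exists_ca_cb x
  simp only [MetricCoeff.scal, Fin.sum_univ_two, inv_G, ric_G]
  simp
  simp only [ha, hb]
  field_simp
  simp only [eA, eB]
  ring

lemma ricD_G (i j k : Fin 2) : G.ricD i j k =
    ![![![fun y => 2 * (cub y * (1 + cv y * cvb y) ^ 2 * cb y ^ 3),
          fun y => 2 * (cu y * cub y * cvb y * (1 + cv y * cvb y) * cb y ^ 3)],
        ![fun y => 2 * (cub y ^ 2 * cv y * (1 + cv y * cvb y) * cb y ^ 3),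
          fun y => 2 * (cu y * cub y ^ 2 * cv y * cvb y * cb y ^ 3)
            + -(2 * (cub y * ca y * cb y ^ 2))]],
      ![![fun y => 2 * (cu y * cub y * cvb y * (1 + cv y * cvb y) * cb y ^ 3),
          fun y => 2 * (cu y ^ 2 * cub y * cvb y ^ 2 * cb y ^ 3)],
        ![fun y => 2 * (cu y * cub y ^ 2 * cv y * cvb y * cb y ^ 3)
            + -(2 * (cub y * ca y * cb y ^ 2)),
          fun y => 2 * (cu y ^ 2 * cub y ^ 2 * cv y * cvb y ^ 2 * ca y * cb y ^ 3)
            + -(4 * (cu y * cub y * cvb y * ca y ^ 2 * cb y ^ 2))]]] i j k := by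
  ext x
  obtain ⟨A, B, hA, hB, eA, eB, ha, hb⟩ := exists_ca_cb x
  simp only [MetricCoeff.ricD, Fin.sum_univ_two, christoffel_G, ric_G]
  fin_cases i <;> fin_cases j <;> fin_cases k <;>
  simp (disch := fun_prop) [wirt_fun_add, wirt_fun_mul, wirt_fun_neg, wirt_fun_pow, wirt_const,
    wirt_cu, wirt_cub, wirt_cv, wirt_cvb, wirt_ca, wirt_cb] <;>
  simp only [ha, hb] <;> field_simp <;> simp only [eA, eB] <;> ring

lemma star_christoffel_G (p k i : Fin 2) : star (G.christoffel p k i x) =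
    ![![![0, ca x * cv x - cu x * cub x * cv x * cb x],
        ![ca x * cv x - cu x * cub x * cv x * cb x, 2 * cub x * cv x ^ 2 * ca x ^ 2 * cb x]],
      ![![0, cu x * (1 + cv x * cvb x) * cb x],
        ![cu x * (1 + cv x * cvb x) * cb x, -(2 * cv x * ca x * cb x)]]] p k i := by
  rw [christoffel_G]
  have h1 := star_cu x
  have h2 := star_cub x
  have h3 := star_cv x
  have h4 := star_cvb x
  have h5 := star_ca x
  have h6 := star_cb x
  have h7 : star (2 : ℂ) = 2 := star_ofNat 2
  rw [← starRingEnd_apply] at *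
  fin_cases p <;> fin_cases k <;> fin_cases i <;>
  simp [-mul_eq_mul_right_iff, h1, h2, h3, h4, h5, h6, h7, mul_comm (cub x) (cu x),
    mul_comm (cvb x) (cv x)]


/-- Covariant derivatives do not commute, so this tensor is not symmetric in `j` and `l`: unlike for
the curvature, the two middle coefficients of `frameTensor` differ. -/
lemma ricDD_G (i j k l : Fin 2) : G.ricDD i j k l x =
    frameTensor x
      ((2 - 4 * (cu x * cub x * (1 + cv x * cvb x))) * (1 + cv x * cvb x) ^ 2 * cb x ^ 4)
      (4 * (cu x * cub x * (1 + cv x * cvb x)) * ca x * cb x ^ 3)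
      ((-2 + 4 * (cu x * cub x * (1 + cv x * cvb x))) * ca x * cb x ^ 3)
      (-4 * (cu x * cub x * (1 + cv x * cvb x)) * ca x ^ 4 * cb x ^ 2) i j k l := by
  obtain ⟨A, B, hA, hB, eA, eB, ha, hb⟩ := exists_ca_cb x
  simp only [MetricCoeff.ricDD, Fin.sum_univ_two, star_christoffel_G, ricD_G]
  fin_cases i <;> fin_cases j <;> fin_cases k <;> fin_cases l <;>
  simp (disch := fun_prop) [frameTensor, coframe, coframeBar, wirtBar_fun_add, wirtBar_fun_mul,
    wirtBar_fun_neg, wirtBar_fun_pow, wirtBar_const, wirtBar_cu, wirtBar_cub, wirtBar_cv,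
    wirtBar_cvb, wirtBar_ca, wirtBar_cb] <;>
  simp only [ha, hb] <;> (try field_simp) <;> (try simp only [eA, eB]) <;> ring

end Simanca

/-! ### Full contractions rewritten through tensors with raised barred indices. -/

namespace MetricCoeff

variable {n : ℕ} (g : MetricCoeff n) (x : Cn n)

/-- The Ricci endomorphism. -/
def ricM (i b : Fin n) : ℂ := ∑ j, g.inv b j x * g.ric i j x

/-- The curvature tensor with both barred indices raised. -/
def riemM (i b k d : Fin n) : ℂ := ∑ j, ∑ l, g.inv b j x * g.inv d l x * g.riem i j k l x

def ricDDM (i b k d : Fin n) : ℂ := ∑ j, ∑ l, g.inv b j x * g.inv d l x * g.ricDD i j k l x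

def ricDM (i b k : Fin n) : ℂ := ∑ j, g.inv b j x * g.ricD i j k x

def ricDMBar (b i k : Fin n) : ℂ :=
  ∑ a, ∑ c, g.inv i a x * g.inv k c x * star (g.ricD a b c x)

/-- This and the next three permutations move the sums over barred indices innermost, where each
inverse metric is absorbed into the tensor whose index it raises. An eightfold sum becomes a
fourfold sum of mixed tensors. -/
lemma sum4_reorder {ι : Type*} [Fintype ι] (F : ι → ι → ι → ι → ℂ) :
    ∑ i, ∑ j, ∑ a, ∑ b, F i j a b = ∑ i, ∑ b, ∑ j, ∑ a, F i j a b := by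
  have h : ∑ p : ι × ι × ι × ι, F p.1 p.2.1 p.2.2.1 p.2.2.2
      = ∑ p : ι × ι × ι × ι, F p.1 p.2.2.1 p.2.2.2 p.2.1 :=
    Fintype.sum_equiv ⟨fun p => (p.1, p.2.2.2, p.2.1, p.2.2.1),
      fun p => (p.1, p.2.2.1, p.2.2.2, p.2.1), fun _ => rfl, fun _ => rfl⟩ _ _ fun _ => rfl
  simpa only [Fintype.sum_prod_type] using h

lemma sum6_reorder {ι : Type*} [Fintype ι] (F : ι → ι → ι → ι → ι → ι → ℂ) :
    ∑ i, ∑ j, ∑ k, ∑ a, ∑ b, ∑ c, F i j k a b c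
      = ∑ i, ∑ b, ∑ k, ∑ j, ∑ a, ∑ c, F i j k a b c := by
  have h : ∑ p : ι × ι × ι × ι × ι × ι,
        F p.1 p.2.1 p.2.2.1 p.2.2.2.1 p.2.2.2.2.1 p.2.2.2.2.2
      = ∑ p : ι × ι × ι × ι × ι × ι,
        F p.1 p.2.2.2.1 p.2.2.1 p.2.2.2.2.1 p.2.1 p.2.2.2.2.2 :=
    Fintype.sum_equiv ⟨fun p => (p.1, p.2.2.2.2.1, p.2.2.1, p.2.1, p.2.2.2.1, p.2.2.2.2.2),
      fun p => (p.1, p.2.2.2.1, p.2.2.1, p.2.2.2.2.1, p.2.1, p.2.2.2.2.2),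
      fun _ => rfl, fun _ => rfl⟩ _ _ fun _ => rfl
  simpa only [Fintype.sum_prod_type] using h

lemma sum8_reorder {ι : Type*} [Fintype ι] (F : ι → ι → ι → ι → ι → ι → ι → ι → ℂ) :
    ∑ i, ∑ j, ∑ k, ∑ l, ∑ a, ∑ b, ∑ c, ∑ d, F i j k l a b c d
      = ∑ i, ∑ b, ∑ k, ∑ d, ∑ j, ∑ l, ∑ a, ∑ c, F i j k l a b c d := by
  have h : ∑ p : ι × ι × ι × ι × ι × ι × ι × ι,
        F p.1 p.2.1 p.2.2.1 p.2.2.2.1 p.2.2.2.2.1 p.2.2.2.2.2.1 p.2.2.2.2.2.2.1 p.2.2.2.2.2.2.2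
      = ∑ p : ι × ι × ι × ι × ι × ι × ι × ι,
        F p.1 p.2.2.2.2.1 p.2.2.1 p.2.2.2.2.2.1 p.2.2.2.2.2.2.1 p.2.1 p.2.2.2.2.2.2.2
          p.2.2.2.1 :=
    Fintype.sum_equiv ⟨fun p => (p.1, p.2.2.2.2.2.1, p.2.2.1, p.2.2.2.2.2.2.2, p.2.1, p.2.2.2.1,
        p.2.2.2.2.1, p.2.2.2.2.2.2.1),
      fun p => (p.1, p.2.2.2.2.1, p.2.2.1, p.2.2.2.2.2.1, p.2.2.2.2.2.2.1, p.2.1,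
        p.2.2.2.2.2.2.2, p.2.2.2.1),
      fun _ => rfl, fun _ => rfl⟩ _ _ fun _ => rfl
  simpa only [Fintype.sum_prod_type] using h

lemma sum10_reorder {ι : Type*} [Fintype ι] (F : ι → ι → ι → ι → ι → ι → ι → ι → ι → ι → ℂ) :
    ∑ i, ∑ j, ∑ k, ∑ a, ∑ b, ∑ c, ∑ d, ∑ p, ∑ q, ∑ e, F i j k a b c d p q e
      = ∑ i, ∑ b, ∑ k, ∑ p, ∑ e, ∑ j, ∑ c, ∑ q, ∑ a, ∑ d, F i j k a b c d p q e := by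
  have h : ∑ p : ι × ι × ι × ι × ι × ι × ι × ι × ι × ι,
        F p.1 p.2.1 p.2.2.1 p.2.2.2.1 p.2.2.2.2.1 p.2.2.2.2.2.1 p.2.2.2.2.2.2.1 p.2.2.2.2.2.2.2.1
          p.2.2.2.2.2.2.2.2.1 p.2.2.2.2.2.2.2.2.2
      = ∑ p : ι × ι × ι × ι × ι × ι × ι × ι × ι × ι,
        F p.1 p.2.2.2.2.2.1 p.2.2.1 p.2.2.2.2.2.2.2.2.1 p.2.1 p.2.2.2.2.2.2.1
          p.2.2.2.2.2.2.2.2.2 p.2.2.2.1 p.2.2.2.2.2.2.2.1 p.2.2.2.2.1 :=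
    Fintype.sum_equiv ⟨fun p => (p.1, p.2.2.2.2.1, p.2.2.1, p.2.2.2.2.2.2.2.1,
        p.2.2.2.2.2.2.2.2.2, p.2.1, p.2.2.2.2.2.1, p.2.2.2.2.2.2.2.2.1, p.2.2.2.1,
        p.2.2.2.2.2.2.1),
      fun p => (p.1, p.2.2.2.2.2.1, p.2.2.1, p.2.2.2.2.2.2.2.2.1, p.2.1, p.2.2.2.2.2.2.1,
          p.2.2.2.2.2.2.2.2.2, p.2.2.2.1, p.2.2.2.2.2.2.2.1, p.2.2.2.2.1),
      fun _ => rfl, fun _ => rfl⟩ _ _ fun _ => rfl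
  simpa only [Fintype.sum_prod_type] using h

lemma normSqRic_eq (h : ∀ i j, star (g.ric i j x) = g.ric j i x) :
    g.normSqRic x = ∑ i, ∑ b, g.ricM x i b * g.ricM x b i := by
  simp only [normSqRic, h]
  rw [sum4_reorder]
  simp only [ricM, Finset.sum_mul]
  simp only [Finset.mul_sum]
  refine Finset.sum_congr rfl fun i _ => Finset.sum_congr rfl fun b _ =>
    Finset.sum_congr rfl fun j _ => Finset.sum_congr rfl fun a _ => ?_
  ring

/-- The Hermitian symmetry removes the conjugate, so the second factor also has two barred indices
that the remaining inverse metrics raise. -/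
lemma normSqRiem_eq (h : ∀ i j k l, star (g.riem i j k l x) = g.riem j i l k x) :
    g.normSqRiem x = ∑ i, ∑ b, ∑ k, ∑ d, g.riemM x i b k d * g.riemM x b i d k := by
  simp only [normSqRiem, h]
  rw [sum8_reorder]
  simp only [riemM, Finset.sum_mul]
  simp only [Finset.mul_sum]
  refine Finset.sum_congr rfl fun i _ => Finset.sum_congr rfl fun b _ =>
    Finset.sum_congr rfl fun k _ => Finset.sum_congr rfl fun d _ =>
    Finset.sum_congr rfl fun j _ => Finset.sum_congr rfl fun l _ =>
    Finset.sum_congr rfl fun a _ => Finset.sum_congr rfl fun c _ => ?_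
  ring

lemma ricDDRiem_eq :
    g.ricDDRiem x = ∑ i, ∑ b, ∑ k, ∑ d, g.ricDDM x i b k d * g.riemM x b i d k := by
  simp only [ricDDRiem]
  rw [sum8_reorder]
  simp only [ricDDM, riemM, Finset.sum_mul]
  simp only [Finset.mul_sum]
  refine Finset.sum_congr rfl fun i _ => Finset.sum_congr rfl fun b _ =>
    Finset.sum_congr rfl fun k _ => Finset.sum_congr rfl fun d _ =>
    Finset.sum_congr rfl fun j _ => Finset.sum_congr rfl fun l _ =>
    Finset.sum_congr rfl fun a _ => Finset.sum_congr rfl fun c _ => ?_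
  ring

lemma riemRicRic_eq :
    g.riemRicRic x = ∑ i, ∑ b, ∑ k, ∑ d, g.riemM x i b k d * (g.ricM x b i * g.ricM x d k) := by
  simp only [riemRicRic]
  rw [sum8_reorder]
  simp only [ricM, riemM, Finset.sum_mul]
  simp only [Finset.mul_sum]
  refine Finset.sum_congr rfl fun i _ => Finset.sum_congr rfl fun b _ =>
    Finset.sum_congr rfl fun k _ => Finset.sum_congr rfl fun d _ =>
    Finset.sum_congr rfl fun j _ => Finset.sum_congr rfl fun l _ =>
    Finset.sum_congr rfl fun a _ => Finset.sum_congr rfl fun c _ => ?_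
  ring

lemma normSqDRic_eq :
    g.normSqDRic x = ∑ i, ∑ b, ∑ k, g.ricDM x i b k * g.ricDMBar x b i k := by
  simp only [normSqDRic]
  rw [sum6_reorder]
  simp only [ricDM, ricDMBar, Finset.sum_mul]
  simp only [Finset.mul_sum]
  refine Finset.sum_congr rfl fun i _ => Finset.sum_congr rfl fun b _ =>
    Finset.sum_congr rfl fun k _ => Finset.sum_congr rfl fun j _ =>
    Finset.sum_congr rfl fun a _ => Finset.sum_congr rfl fun c _ => ?_
  ring

lemma ricRiemRiem_eq :
    g.ricRiemRiem x = ∑ i, ∑ b, ∑ k, ∑ p, ∑ e,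
      g.ricM x i b * (g.riemM x b k p e * g.riemM x k i e p) := by
  simp only [ricRiemRiem]
  rw [sum10_reorder]
  simp only [ricM, riemM, Finset.sum_mul]
  simp only [Finset.mul_sum]
  refine Finset.sum_congr rfl fun i _ => Finset.sum_congr rfl fun b _ =>
    Finset.sum_congr rfl fun k _ => Finset.sum_congr rfl fun p _ =>
    Finset.sum_congr rfl fun e _ => Finset.sum_congr rfl fun j _ =>
    Finset.sum_congr rfl fun c _ => Finset.sum_congr rfl fun q _ =>
    Finset.sum_congr rfl fun a _ => Finset.sum_congr rfl fun d _ => ?_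
  ring

end MetricCoeff

/-! ### Curvature invariants of the Simanca metric and vanishing of `a₃`. -/

namespace Simanca

variable (x : Cn 2)

/-- The frame dual to `coframe`. -/
def frame (y : Cn 2) : Fin 2 → Fin 2 → ℂ := ![![1, 0], ![-(cu y * cvb y * ca y), 1]]

def mixedTensor (y : Cn 2) (c0000 c0011 c0110 c1111 : ℂ) (i b k d : Fin 2) : ℂ :=
  let t := coframe y
  let e := frame y
  c0000 * t 0 i * e 0 b * t 0 k * e 0 d
    + c0011 * (t 0 i * e 0 b * t 1 k * e 1 d + t 1 i * e 0 b * t 0 k * e 1 d)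
    + c0110 * (t 0 i * e 1 b * t 1 k * e 0 d + t 1 i * e 1 b * t 0 k * e 0 d)
    + c1111 * t 1 i * e 1 b * t 1 k * e 1 d

/-- In the coframe the metric is diagonal with entries `1 + |v|²` and `(1 + |z|²) / (1 + |v|²)²`;
raising an index divides by these entries and passes to the dual frame. -/
lemma sum_inv_coframeBar (b α : Fin 2) : ∑ j, G.inv b j x * coframeBar x α j
    = ![ca x, (1 + cv x * cvb x) ^ 2 * cb x] α * frame x α b := by
  obtain ⟨A, B, hA, hB, eA, eB, ha, hb⟩ := exists_ca_cb x
  simp only [Fin.sum_univ_two, inv_G]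
  fin_cases b <;> fin_cases α <;> simp [coframeBar, frame, ha, hb] <;>
  (try field_simp) <;> (try simp only [eA, eB]) <;> ring

lemma raise_frameTensor (c0000 c0011 c0110 c1111 : ℂ) (i b k d : Fin 2) :
    ∑ j, ∑ l, G.inv b j x * G.inv d l x * frameTensor x c0000 c0011 c0110 c1111 i j k l
      = mixedTensor x (c0000 * ca x ^ 2) (c0011 * ca x * ((1 + cv x * cvb x) ^ 2 * cb x))
        (c0110 * ca x * ((1 + cv x * cvb x) ^ 2 * cb x))
        (c1111 * ((1 + cv x * cvb x) ^ 2 * cb x) ^ 2) i b k d := by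
  have h1 := sum_inv_coframeBar x b 0
  have h2 := sum_inv_coframeBar x b 1
  have h3 := sum_inv_coframeBar x d 0
  have h4 := sum_inv_coframeBar x d 1
  simp only [Matrix.cons_val_zero, Matrix.cons_val_one] at h1 h2 h3 h4
  set r := (1 + cv x * cvb x) ^ 2 * cb x
  have e : ∀ j l, G.inv b j x * G.inv d l x * frameTensor x c0000 c0011 c0110 c1111 i j k l
      = c0000 * coframe x 0 i * coframe x 0 k
          * ((G.inv b j x * coframeBar x 0 j) * (G.inv d l x * coframeBar x 0 l))
        + c0011 * (coframe x 0 i * coframe x 1 k + coframe x 1 i * coframe x 0 k)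
          * ((G.inv b j x * coframeBar x 0 j) * (G.inv d l x * coframeBar x 1 l))
        + c0110 * (coframe x 0 i * coframe x 1 k + coframe x 1 i * coframe x 0 k)
          * ((G.inv b j x * coframeBar x 1 j) * (G.inv d l x * coframeBar x 0 l))
        + c1111 * coframe x 1 i * coframe x 1 k
          * ((G.inv b j x * coframeBar x 1 j) * (G.inv d l x * coframeBar x 1 l)) := by
    intro j l
    simp only [frameTensor]
    ring
  simp only [e, Finset.sum_add_distrib, ← Finset.mul_sum, ← Finset.sum_mul, h1, h2, h3, h4,
    mixedTensor]
  ring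

/-- After raising, the powers of `1 + |v|²` cancel, so that every frame component depends on `|z|²`
alone. -/
lemma riemM_G (i b k d : Fin 2) : G.riemM x i b k d =
    mixedTensor x 0 (cb x ^ 2) (cb x ^ 2) (-2 * cb x ^ 2) i b k d := by
  obtain ⟨A, B, hA, hB, eA, eB, ha, hb⟩ := exists_ca_cb x
  simp only [MetricCoeff.riemM, riem_G, raise_frameTensor]
  congr 1 <;> simp only [← eA, ha] <;> first | field_simp; done | ring

lemma ricDDM_G (i b k d : Fin 2) : G.ricDDM x i b k d =
    mixedTensor x ((2 - 4 * (cu x * cub x * (1 + cv x * cvb x))) * cb x ^ 4)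
      (4 * (cu x * cub x * (1 + cv x * cvb x)) * cb x ^ 4)
      ((-2 + 4 * (cu x * cub x * (1 + cv x * cvb x))) * cb x ^ 4)
      (-4 * (cu x * cub x * (1 + cv x * cvb x)) * cb x ^ 4) i b k d := by
  obtain ⟨A, B, hA, hB, eA, eB, ha, hb⟩ := exists_ca_cb x
  simp only [MetricCoeff.ricDDM, ricDD_G, raise_frameTensor]
  congr 1 <;> simp only [← eA, ha] <;> field_simp

/-- The eigenvalues are opposite: `-b²` in the radial direction `0`, `b²` in the direction `1`. -/
lemma ricM_G (i b : Fin 2) : G.ricM x i b =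
    cb x ^ 2 * (coframe x 1 i * frame x 1 b - coframe x 0 i * frame x 0 b) := by
  obtain ⟨A, B, hA, hB, eA, eB, ha, hb⟩ := exists_ca_cb x
  simp only [MetricCoeff.ricM, Fin.sum_univ_two, inv_G, ric_G]
  fin_cases i <;> fin_cases b <;> simp [coframe, frame, ha, hb] <;>
  (try field_simp) <;> (try simp only [eA, eB]) <;> ring

lemma ricDM_G (i b k : Fin 2) : G.ricDM x i b k =
    2 * cub x * (1 + cv x * cvb x) * cb x ^ 3 *
      (coframe x 0 i * frame x 0 b * coframe x 0 k - coframe x 0 i * frame x 1 b * coframe x 1 k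
        - coframe x 1 i * frame x 1 b * coframe x 0 k) := by
  obtain ⟨A, B, hA, hB, eA, eB, ha, hb⟩ := exists_ca_cb x
  simp only [MetricCoeff.ricDM, Fin.sum_univ_two, inv_G, ricD_G]
  fin_cases i <;> fin_cases b <;> fin_cases k <;> simp [coframe, frame, ha, hb] <;>
  (try field_simp) <;> (try simp only [eA, eB]) <;> ring

lemma star_ricD_G (i j k : Fin 2) : star (G.ricD i j k x) =
    2 * cu x * (1 + cv x * cvb x) ^ 2 * cb x ^ 3
        * coframeBar x 0 i * coframe x 0 j * coframeBar x 0 k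
      - 2 * cu x * ca x * cb x ^ 2 * (coframeBar x 0 i * coframe x 1 j * coframeBar x 1 k
        + coframeBar x 1 i * coframe x 1 j * coframeBar x 0 k) := by
  obtain ⟨A, B, hA, hB, eA, eB, ha, hb⟩ := exists_ca_cb x
  have h1 := star_cu x
  have h2 := star_cub x
  have h3 := star_cv x
  have h4 := star_cvb x
  have h5 := star_ca x
  have h6 := star_cb x
  have h7 : star (2 : ℂ) = 2 := star_ofNat 2
  have h8 : star (4 : ℂ) = 4 := star_ofNat 4
  simp only [ricD_G]
  rw [← starRingEnd_apply] at *
  fin_cases i <;> fin_cases j <;> fin_cases k <;>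
  simp [coframe, coframeBar, h1, h2, h3, h4, h5, h6, h7, h8] <;>
  simp only [ha, hb] <;> (try field_simp) <;> (try simp only [eA, eB]) <;> ring

lemma ricDMBar_G (b i k : Fin 2) : G.ricDMBar x b i k =
    2 * cu x * cb x ^ 3 *
      (frame x 0 i * coframe x 0 b * frame x 0 k - frame x 0 i * coframe x 1 b * frame x 1 k
        - frame x 1 i * coframe x 1 b * frame x 0 k) := by
  obtain ⟨A, B, hA, hB, eA, eB, ha, hb⟩ := exists_ca_cb x
  have h1 := sum_inv_coframeBar x i 0
  have h2 := sum_inv_coframeBar x i 1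
  have h3 := sum_inv_coframeBar x k 0
  have h4 := sum_inv_coframeBar x k 1
  simp only [Matrix.cons_val_zero, Matrix.cons_val_one] at h1 h2 h3 h4
  simp only [MetricCoeff.ricDMBar, star_ricD_G]
  have e : ∀ a c, G.inv i a x * G.inv k c x * (2 * cu x * (1 + cv x * cvb x) ^ 2 * cb x ^ 3
        * coframeBar x 0 a * coframe x 0 b * coframeBar x 0 c
      - 2 * cu x * ca x * cb x ^ 2 * (coframeBar x 0 a * coframe x 1 b * coframeBar x 1 c
        + coframeBar x 1 a * coframe x 1 b * coframeBar x 0 c))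
      = 2 * cu x * (1 + cv x * cvb x) ^ 2 * cb x ^ 3 * coframe x 0 b
          * ((G.inv i a x * coframeBar x 0 a) * (G.inv k c x * coframeBar x 0 c))
        - 2 * cu x * ca x * cb x ^ 2 * coframe x 1 b
          * ((G.inv i a x * coframeBar x 0 a) * (G.inv k c x * coframeBar x 1 c))
        - 2 * cu x * ca x * cb x ^ 2 * coframe x 1 b
          * ((G.inv i a x * coframeBar x 1 a) * (G.inv k c x * coframeBar x 0 c)) := by
    intro a c
    ring
  simp only [e, Finset.sum_sub_distrib, ← Finset.mul_sum, ← Finset.sum_mul, h1, h2, h3, h4]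
  simp only [← eA, ha]
  field_simp

lemma star_ric_G (i j : Fin 2) : star (G.ric i j x) = G.ric j i x := by
  have h1 := star_cu x
  have h2 := star_cub x
  have h3 := star_cv x
  have h4 := star_cvb x
  have h5 := star_ca x
  have h6 := star_cb x
  have h7 : star (2 : ℂ) = 2 := star_ofNat 2
  simp only [ric_G]
  rw [← starRingEnd_apply] at *
  fin_cases i <;> fin_cases j <;> simp [h1, h2, h3, h4, h5, h6, h7] <;> ring_nf <;> simp

lemma star_coframe (α i : Fin 2) : star (coframe x α i) = coframeBar x α i := by
  have h1 := star_cu x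
  have h4 := star_cvb x
  have h5 := star_ca x
  rw [← starRingEnd_apply] at *
  fin_cases α <;> fin_cases i <;> simp [coframe, coframeBar, h1, h4, h5]

lemma star_coframeBar (α i : Fin 2) : star (coframeBar x α i) = coframe x α i := by
  rw [← star_coframe, star_star]

lemma star_riem_G (i j k l : Fin 2) : star (G.riem i j k l x) = G.riem j i l k x := by
  simp only [riem_G, frameTensor, star_add, star_mul', star_coframe, star_coframeBar, star_ca,
    star_cb, star_pow, star_neg, star_zero, star_ofNat]
  ring

lemma normSqRic_G : G.normSqRic x = 2 * cb x ^ 4 := by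
  rw [MetricCoeff.normSqRic_eq _ _ (star_ric_G x)]
  simp only [ricM_G, Fin.sum_univ_two]
  simp [coframe, frame]
  ring

lemma normSqRiem_G : G.normSqRiem x = 8 * cb x ^ 4 := by
  rw [MetricCoeff.normSqRiem_eq _ _ (star_riem_G x)]
  simp only [riemM_G, Fin.sum_univ_two]
  simp [mixedTensor, coframe, frame]
  ring

lemma ricDDRiem_G : G.ricDDRiem x =
    (24 * (cu x * cub x * (1 + cv x * cvb x)) - 4) * cb x ^ 6 := by
  rw [MetricCoeff.ricDDRiem_eq]
  simp only [riemM_G, ricDDM_G, Fin.sum_univ_two]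
  simp [mixedTensor, coframe, frame]
  ring

lemma riemRicRic_G : G.riemRicRic x = -4 * cb x ^ 6 := by
  rw [MetricCoeff.riemRicRic_eq]
  simp only [riemM_G, ricM_G, Fin.sum_univ_two]
  simp [mixedTensor, coframe, frame]
  ring

lemma ricRiemRiem_G : G.ricRiemRiem x = 4 * cb x ^ 6 := by
  rw [MetricCoeff.ricRiemRiem_eq]
  simp only [riemM_G, ricM_G, Fin.sum_univ_two]
  simp [mixedTensor, coframe, frame]
  ring

lemma normSqDRic_G : G.normSqDRic x =
    12 * (cu x * cub x * (1 + cv x * cvb x)) * cb x ^ 6 := by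
  rw [MetricCoeff.normSqDRic_eq]
  simp only [ricDM_G, ricDMBar_G, Fin.sum_univ_two]
  simp [coframe, frame]
  ring

lemma laplacian_G_zero : G.laplacian (fun _ => 0) = fun _ => 0 := by
  have h : ∀ j, wirtBar j (fun _ : Cn 2 => (0 : ℂ)) = fun _ => 0 := fun j => by
    ext y
    exact wirtBar_const j 0
  ext y
  simp [MetricCoeff.laplacian, h, wirt_const]

theorem tyz3_G : G.tyz3 x = 0 := by
  -- The identity behind it is `|R|² = 4 |Ric|²`, namely `8 b⁴ = 4 · 2 b⁴`.
  have h : (fun y => G.normSqRiem y - 4 * G.normSqRic y + 8 * G.scal y ^ 2) = fun _ => 0 := by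
    ext y
    rw [normSqRiem_G, normSqRic_G, scal_G]
    ring
  have h' : ∀ j, wirtBar j (fun _ : Cn 2 => (0 : ℂ)) = fun _ => 0 := fun j => by
    ext y
    exact wirtBar_const j 0
  have h2 : G.ricHessScal x = 0 := by
    simp [MetricCoeff.ricHessScal, scal_G, h', wirt_const]
  have h3 : G.normSqDScal x = 0 := by
    simp [MetricCoeff.normSqDScal, scal_G, wirt_const]
  simp only [MetricCoeff.tyz3, h, MetricCoeff.divDivScalRic, MetricCoeff.divDivRiemRic, h2, h3]
  -- What remains is `b⁶ / 24` times `-2 · 12 s + (24 s - 4) + 2 · 4 - 4 = 0`. The two occurrences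
  -- of `σ₃(Ric)` cancel, so its value is not needed.
  simp only [scal_G, laplacian_G_zero, ricDDRiem_G, riemRicRic_G, ricRiemRiem_G, normSqDRic_G]
  ring

lemma ric_G_ne_zero : G.ric 0 0 x ≠ 0 := by
  simp only [ric_G]
  exact neg_ne_zero.2 (mul_ne_zero (one_add_cv_ne x) (pow_ne_zero _ (cb_ne x)))

end Simanca

/-! ### The Kähler potential -/

namespace Simanca

/-- The smooth part `|u|² (1 + |v|²) + log (1 + |v|²)` of the Kähler potential. -/
def pot (y : Cn 2) : ℝ := ‖y 0‖ ^ 2 * (1 + ‖y 1‖ ^ 2) + Real.log (1 + ‖y 1‖ ^ 2)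

lemma ofReal_norm_sq (z : ℂ) : ((‖z‖ ^ 2 : ℝ) : ℂ) = z * star z := by
  simp [Complex.mul_conj, Complex.normSq_eq_norm_sq]

lemma contDiff_norm_sq_coord (k : Fin 2) : ContDiff ℝ ∞ fun y : Cn 2 => ‖y k‖ ^ 2 :=
  ((EuclideanSpace.proj k : Cn 2 →L[ℂ] ℂ).restrictScalars ℝ).contDiff.norm_sq ℝ

lemma differentiable_norm_sq_coord (k : Fin 2) :
    Differentiable ℝ fun y : Cn 2 => ‖y k‖ ^ 2 :=
  (contDiff_norm_sq_coord k).differentiable (by simp)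

lemma one_add_norm_sq_ne (y : Cn 2) (k : Fin 2) : 1 + ‖y k‖ ^ 2 ≠ 0 := by positivity

lemma contDiff_pot : ContDiff ℝ ∞ pot :=
  ((contDiff_norm_sq_coord 0).mul (contDiff_const.add (contDiff_norm_sq_coord 1))).add
    ((contDiff_const.add (contDiff_norm_sq_coord 1)).log fun y => one_add_norm_sq_ne y 1)

lemma wirtBar_pot (j : Fin 2) : wirtBar j (fun y => (pot y : ℂ)) =
    ![fun y => cu y * (1 + cv y * cvb y), fun y => cu y * cub y * cv y + cv y * ca y] j := by
  ext x
  have h : (fun y => (pot y : ℂ)) = fun y => cu y * cub y * (1 + cv y * cvb y)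
      + (Real.log (1 + ‖y 1‖ ^ 2) : ℂ) := by
    ext y
    simp only [pot, Complex.ofReal_add, Complex.ofReal_mul, ofReal_norm_sq]
    simp [cu, cub, cv, cvb]
  have hd : DifferentiableAt ℝ (fun y : Cn 2 => 1 + ‖y 1‖ ^ 2) x :=
    (differentiable_norm_sq_coord 1 x).const_add 1
  have hl : DifferentiableAt ℝ (fun y : Cn 2 => (Real.log (1 + ‖y 1‖ ^ 2) : ℂ)) x :=
    Complex.ofRealCLM.differentiableAt.comp x (hd.log (one_add_norm_sq_ne x 1))
  have h1 : ∀ y : Cn 2, ((1 + ‖y 1‖ ^ 2 : ℝ) : ℂ) = 1 + cv y * cvb y := fun y => by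
    rw [Complex.ofReal_add, ofReal_norm_sq]
    simp [cv, cvb]
  rw [h, wirtBar_fun_add j (by fun_prop) hl, wirtBar_ofReal_log j hd (one_add_norm_sq_ne x 1)]
  simp only [h1]
  fin_cases j <;>
  simp (disch := fun_prop) [wirtBar_fun_add, wirtBar_fun_mul, wirtBar_const,
    wirtBar_cu, wirtBar_cub, wirtBar_cv, wirtBar_cvb, ca]
  ring

lemma wirtBar_log_norm_sq (j k : Fin 2) {x : Cn 2} (hx : x k ≠ 0) :
    wirtBar j (fun y : Cn 2 => (Real.log (‖y k‖ ^ 2) : ℂ)) x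
      = (if k = j then 1 else 0) * star ((x k)⁻¹) := by
  have hd : DifferentiableAt ℝ (fun y : Cn 2 => ‖y k‖ ^ 2) x := differentiable_norm_sq_coord k x
  have hk : DifferentiableAt ℝ (fun y : Cn 2 => y k) x := by fun_prop
  rw [wirtBar_ofReal_log j hd (by positivity)]
  simp only [ofReal_norm_sq]
  rw [wirtBar_fun_mul j hk hk.star, wirtBar_coord, wirtBar_fun_star j hk, wirt_coord]
  have hs : star (x k) ≠ 0 := star_ne_zero.2 hx
  rw [star_inv₀]
  split_ifs
  · simp only [star_one, zero_mul, zero_add]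
    field_simp
  · simp

lemma ddbar_pot (i j : Fin 2) (x : Cn 2) : ddbar pot i j x = G i j x := by
  rw [ddbar, wirtBar_pot]
  fin_cases i <;> fin_cases j <;>
    simp (disch := fun_prop) [G, wirt_fun_add, wirt_fun_mul, wirt_const,
      wirt_cu, wirt_cub, wirt_cv, wirt_cvb, wirt_ca]
  have := one_add_cv_ne x
  simp only [ca]
  field_simp
  ring

/-- `∂∂̄ log |f|² = 0` for a coordinate function `f`, so that such terms do not change the metric. -/
lemma ddbar_pot_add (c : ℝ) (k i j : Fin 2) {x : Cn 2} (hx : x k ≠ 0) :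
    ddbar (fun y => pot y + c * Real.log (‖y k‖ ^ 2)) i j x = G i j x := by
  have hk : Differentiable ℝ (fun y : Cn 2 => y k) := by fun_prop
  have hnhds : ∀ᶠ y in nhds x, y k ≠ 0 := hk.continuous.continuousAt.eventually_ne hx
  have key : wirtBar j (fun y => ((pot y + c * Real.log (‖y k‖ ^ 2) : ℝ) : ℂ)) =ᶠ[nhds x]
      fun y => wirtBar j (fun y => (pot y : ℂ)) y
        + c * ((if k = j then 1 else 0) * star ((y k)⁻¹)) := by
    filter_upwards [hnhds] with y hy
    have hd : DifferentiableAt ℝ (fun y : Cn 2 => ‖y k‖ ^ 2) y := differentiable_norm_sq_coord k y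
    have hl : DifferentiableAt ℝ (fun y : Cn 2 => (Real.log (‖y k‖ ^ 2) : ℂ)) y :=
      Complex.ofRealCLM.differentiableAt.comp y (hd.log (by positivity))
    have hp : DifferentiableAt ℝ (fun y : Cn 2 => (pot y : ℂ)) y :=
      Complex.ofRealCLM.differentiableAt.comp y (contDiff_pot.differentiable (by simp) y)
    simp only [Complex.ofReal_add, Complex.ofReal_mul]
    rw [wirtBar_fun_add j hp (hl.const_mul _), wirtBar_fun_mul j (by fun_prop) hl, wirtBar_const,
      wirtBar_log_norm_sq j k hy]
    ring
  have hinv : DifferentiableAt ℝ (fun y : Cn 2 => (y k)⁻¹) x := (hk x).inv hx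
  have hinvBar : wirtBar i (fun y : Cn 2 => (y k)⁻¹) x = 0 := by
    rw [wirtBar_fun_inv i (hk x) hx, wirtBar_coord]
    simp
  have hw : wirt i (fun y : Cn 2 => (c : ℂ) * ((if k = j then 1 else 0) * star ((y k)⁻¹))) x = 0 := by
    rw [wirt_fun_mul i (by fun_prop) (by exact (differentiableAt_const _).mul hinv.star),
      wirt_fun_mul i (by fun_prop) hinv.star, wirt_const, wirt_const, wirt_fun_star i hinv, hinvBar]
    simp
  rw [ddbar, wirt_congr i key, wirtBar_pot, wirt_fun_add i ?_ ?_, hw, add_zero]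
  · rw [← wirtBar_pot]
    exact ddbar_pot i j x
  · fin_cases j
    · simp
      fun_prop
    · simp
      fun_prop
  · exact (differentiableAt_const _).mul ((differentiableAt_const _).mul hinv.star)

/-- The Hermitian form with coefficients `G`, written with the differential of the blow-down map
`(u, v) ↦ (u, u v)`. -/
def form (y V W : Cn 2) : ℂ :=
  V 0 * star (W 0) + (y 1 * V 0 + y 0 * V 1) * star (y 1 * W 0 + y 0 * W 1)
    + ca y ^ 2 * (V 1 * star (W 1))

lemma form_single (y : Cn 2) (i j : Fin 2) :
    form y (EuclideanSpace.single i 1) (EuclideanSpace.single j 1) = G i j y := by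
  fin_cases i <;> fin_cases j <;> simp [form, G, cu, cub, cv, cvb]
  ring

lemma ca_eq_ofReal (y : Cn 2) : ca y = (((1 + ‖y 1‖ ^ 2)⁻¹ : ℝ) : ℂ) := by
  rw [ca, cv_mul_cvb]
  push_cast
  rfl

lemma form_self_re (y V : Cn 2) : (form y V V).re =
    ‖V 0‖ ^ 2 + ‖y 1 * V 0 + y 0 * V 1‖ ^ 2 + ((1 + ‖y 1‖ ^ 2)⁻¹) ^ 2 * ‖V 1‖ ^ 2 := by
  rw [form, ca_eq_ofReal, ← ofReal_norm_sq, ← ofReal_norm_sq, ← ofReal_norm_sq,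
    ← Complex.ofReal_pow, ← Complex.ofReal_mul, ← Complex.ofReal_add, ← Complex.ofReal_add,
    Complex.ofReal_re]

/-- The flat part controls `V 0` but degenerates on the exceptional divisor in the direction of `V
1`; there the Fubini-Study term takes over. -/
lemma form_pos (y V : Cn 2) (hV : V ≠ 0) : 0 < (form y V V).re := by
  rw [form_self_re]
  by_cases h0 : V 0 = 0
  · have h1 : V 1 ≠ 0 := fun h1 => hV (by ext i; fin_cases i <;> simp [h0, h1])
    have : 0 < ((1 + ‖y 1‖ ^ 2)⁻¹) ^ 2 * ‖V 1‖ ^ 2 := by positivity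
    positivity
  · positivity

lemma star_form (y V W : Cn 2) : star (form y V W) = form y W V := by
  simp only [form, star_add, star_mul', star_pow, star_ca, star_star]
  ring

lemma contDiff_coord (k : Fin 2) : ContDiff ℝ ∞ fun y : Cn 2 => y k :=
  ((EuclideanSpace.proj k : Cn 2 →L[ℂ] ℂ).restrictScalars ℝ).contDiff

lemma contDiff_star_coord (k : Fin 2) : ContDiff ℝ ∞ fun y : Cn 2 => star (y k) :=
  (starL' ℝ : ℂ ≃L[ℝ] ℂ).contDiff.comp (contDiff_coord k)

lemma contDiff_ca : ContDiff ℝ ∞ ca :=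
  (contDiff_const.add ((contDiff_coord 1).mul (contDiff_star_coord 1))).inv one_add_cv_ne

lemma contDiff_G (i j : Fin 2) : ContDiff ℝ ∞ (G i j) := by
  fin_cases i <;> fin_cases j
  · exact contDiff_const.add ((contDiff_coord 1).mul (contDiff_star_coord 1))
  · exact (contDiff_star_coord 0).mul (contDiff_coord 1)
  · exact (contDiff_coord 0).mul (contDiff_star_coord 1)
  · exact ((contDiff_coord 0).mul (contDiff_star_coord 0)).add (contDiff_ca.pow 2)

/-- The vectors on the left are the images of `V` and `W` under the differential of `(u, v) ↦ (u v,
1 / v)`. This map swaps the two components of the blow-down, hence the two flat terms, and `v ↦ 1 /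
v` is an isometry of the Fubini-Study metric. -/
lemma form_transition {y V W : Cn 2} (h : y 1 ≠ 0) :
    form !₂[y 0 * y 1, (y 1)⁻¹] !₂[V 0 * y 1 + y 0 * V 1, -(V 1 * (y 1)⁻¹ ^ 2)]
      !₂[W 0 * y 1 + y 0 * W 1, -(W 1 * (y 1)⁻¹ ^ 2)] = form y V W := by
  have h' : star (y 1) ≠ 0 := star_ne_zero.2 h
  have hA := one_add_cv_ne y
  have hA' : cv y * cvb y + 1 ≠ 0 := by rwa [add_comm]
  simp only [form, ca, cv, cvb, star_add, star_mul'] at *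
  simp
  simp only [← starRingEnd_apply] at *
  -- The identity is rational in the variables and their conjugates taken as independent.
  generalize (starRingEnd ℂ) (y 1) = vb at *
  generalize (starRingEnd ℂ) (y 0) = ub at *
  generalize (starRingEnd ℂ) (V 0) = V0b at *
  generalize (starRingEnd ℂ) (W 0) = W0b at *
  generalize (starRingEnd ℂ) (V 1) = V1b at *
  generalize (starRingEnd ℂ) (W 1) = W1b at *
  have e : 1 + (y 1)⁻¹ * vb⁻¹ = (y 1 * vb + 1) / (y 1 * vb) := by
    field_simp
  rw [e]
  field_simp
  ring

end Simanca

namespace BlowUp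
open Simanca

/-! ### Charts of the blow-up -/

/-- The standard coordinates as a chart. -/
def ch (a : Fin 2) : OpenPartialHomeomorph BlowUp (Cn 2) :=
  core.openPartialHomeomorph (chart a) ⟨a, rfl⟩

lemma mem_atlas_iff (e : OpenPartialHomeomorph BlowUp (Cn 2)) :
    e ∈ atlas (Cn 2) BlowUp ↔ ∃ a, e = ch a := by
  constructor
  · intro he
    obtain ⟨s, ⟨e, rfl⟩, hs⟩ := he
    simp only [Set.mem_iUnion] at hs
    obtain ⟨⟨a, rfl⟩, hs⟩ := hs
    exact ⟨a, hs⟩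
  · rintro ⟨a, rfl⟩
    exact Set.mem_iUnion₂.2 ⟨chart a, ⟨a, rfl⟩, rfl⟩

lemma ch_mem_atlas (a : Fin 2) : ch a ∈ atlas (Cn 2) BlowUp := (mem_atlas_iff _).2 ⟨a, rfl⟩

/-- Potentials, curves, the Riemannian distance and the ALE chart refer to the underlying real
manifold. -/
instance : IsManifold 𝓘(ℝ, Cn 2) ω BlowUp := by
  apply isManifold_of_contDiffOn
  intro e e' he he'
  obtain ⟨a, rfl⟩ := (mem_atlas_iff e).1 he
  obtain ⟨b, rfl⟩ := (mem_atlas_iff e').1 he'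
  have := (contDiffOn_transition a b).restrict_scalars ℝ
  simpa using! this

instance : IsManifold 𝓘(ℝ, Cn 2) ∞ BlowUp := .of_le (n := ω) le_top
instance : IsManifold 𝓘(ℝ, Cn 2) 1 BlowUp := .of_le (n := ω) le_top
instance : IsManifold 𝓘(ℂ, Cn 2) 1 BlowUp := .of_le (n := ω) le_top

lemma ch_symm_mem (a : Fin 2) (y : Cn 2) : (ch a).symm y ∈ (ch a).source :=
  (ch a).map_target (Set.mem_univ y)

lemma ch_right_inv (a : Fin 2) (y : Cn 2) : ch a ((ch a).symm y) = y :=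
  (ch a).right_inv (Set.mem_univ y)

lemma exists_chartAt_eq (p : BlowUp) : ∃ a, chartAt (Cn 2) p = ch a :=
  (mem_atlas_iff _).1 (chart_mem_atlas _ p)

lemma eq_or_eq_rev (a b : Fin 2) : b = a ∨ b = a.rev := by
  fin_cases a <;> fin_cases b <;> simp

lemma blowDown_ch_symm (a : Fin 2) (y : Cn 2) :
    blowDown ((ch a).symm y) = y 0 • dir a (y 1) := rfl

lemma ch_rev_symm (a : Fin 2) (y : Cn 2) :
    ch a.rev ((ch a).symm y) = !₂[y 0 * y 1, (y 1)⁻¹] := by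
  have h := chart_symm_trans a a.rev y
  rw [dir_rev, Fin.rev_rev, dir_self, one_div] at h
  exact h

lemma ch_symm_mem_rev (a : Fin 2) (y : Cn 2) : (ch a).symm y ∈ (ch a.rev).source ↔ y 1 ≠ 0 := by
  have h := chart_symm_trans_source a a.rev
  have h' : y ∈ ((chart a).symm.trans (chart a.rev)).source ↔ (ch a).symm y ∈ (ch a.rev).source := by
    rw [PartialEquiv.trans_source]
    exact ⟨fun h => h.2, fun h => ⟨Set.mem_univ _, h⟩⟩
  rw [← h', h]
  simp

lemma norm_sq_dir (a : Fin 2) (v : ℂ) : ‖dir a v‖ ^ 2 = 1 + ‖v‖ ^ 2 := by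
  rw [EuclideanSpace.norm_sq_eq, Fin.sum_univ_two]
  fin_cases a
  · have h0 := dir_self 0 v
    have h1 := dir_rev 0 v
    simp only [Fin.zero_eta, h0, show (1 : Fin 2) = Fin.rev 0 from rfl, h1]
    simp
  · have h0 := dir_self 1 v
    have h1 := dir_rev 1 v
    simp only [Fin.mk_one, h0, show (0 : Fin 2) = Fin.rev 1 from rfl, h1]
    simp [add_comm]

lemma norm_sq_blowDown_ch_symm (a : Fin 2) (y : Cn 2) :
    ‖blowDown ((ch a).symm y)‖ ^ 2 = ‖y 0‖ ^ 2 * (1 + ‖y 1‖ ^ 2) := by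
  rw [blowDown_ch_symm, norm_smul, mul_pow, norm_sq_dir]

lemma ch_symm_mem_offE (a : Fin 2) (y : Cn 2) : (ch a).symm y ∈ offE ↔ y 0 ≠ 0 := by
  change blowDown ((ch a).symm y) ≠ 0 ↔ _
  rw [blowDown_ch_symm]
  simp [dir_ne_zero]

section Manifold

variable {E F : Type*} [NormedAddCommGroup E] [NormedSpace ℝ E] [NormedAddCommGroup F]
  [NormedSpace ℝ F]

lemma contMDiffAt_of_ch {f : BlowUp → F} {n : ℕ∞ω} {a : Fin 2} {p : BlowUp} (hp : p ∈ (ch a).source)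
    (h : ContDiffAt ℝ n (f ∘ (ch a).symm) (ch a p)) : ContMDiffAt 𝓘(ℝ, Cn 2) 𝓘(ℝ, F) n f p := by
  have h1 : ContMDiffAt 𝓘(ℝ, Cn 2) 𝓘(ℝ, Cn 2) n (ch a) p :=
    ((contMDiffOn_of_mem_maximalAtlas (n := ω)
      (IsManifold.subset_maximalAtlas (ch_mem_atlas a))).contMDiffAt
      ((ch a).open_source.mem_nhds hp)).of_le le_top
  have h2 := h.contMDiffAt.comp p h1
  refine h2.congr_of_eventuallyEq ?_
  filter_upwards [(ch a).open_source.mem_nhds hp] with q hq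
  simp only [Function.comp_apply, (ch a).left_inv hq]

lemma contMDiff_ch_symm (a : Fin 2) :
    ContMDiff 𝓘(ℝ, Cn 2) 𝓘(ℝ, Cn 2) ω (ch a).symm := by
  rw [← contMDiffOn_univ]
  exact contMDiffOn_symm_of_mem_maximalAtlas (n := ω)
      (IsManifold.subset_maximalAtlas (ch_mem_atlas a))

end Manifold

/-! ### The Simanca metric on the blow-up -/

lemma form_add_left (y V V' W : Cn 2) : form y (V + V') W = form y V W + form y V' W := by
  simp only [form, PiLp.add_apply]
  ring

lemma form_smul_left (y : Cn 2) (c : ℂ) (V W : Cn 2) : form y (c • V) W = c * form y V W := by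
  simp only [form, PiLp.smul_apply, smul_eq_mul]
  ring

lemma form_add_right (y V W W' : Cn 2) : form y V (W + W') = form y V W + form y V W' := by
  rw [← star_form, form_add_left, star_add, star_form, star_form]

lemma form_smul_right (y : Cn 2) (c : ℂ) (V W : Cn 2) :
    form y V (c • W) = star c * form y V W := by
  rw [← star_form, form_smul_left, star_mul', star_form]

/-- The field of Hermitian forms given by `Simanca.form` in the preferred charts. -/
def herm (p : BlowUp) :
    TangentSpace 𝓘(ℂ, Cn 2) p →ₗ[ℂ] TangentSpace 𝓘(ℂ, Cn 2) p →ₗ⋆[ℂ] ℂ :=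
  LinearMap.mk₂'ₛₗ (RingHom.id ℂ) (starRingEnd ℂ)
    (fun V W : Cn 2 => form (chartAt (Cn 2) p p) V W)
    (fun V V' W => form_add_left _ V V' W) (fun c V W => form_smul_left _ c V W)
    (fun V W W' => form_add_right _ V W W') (fun c V W => form_smul_right _ c V W)

lemma herm_apply (p : BlowUp) (V W : Cn 2) :
    herm p V W = form (chartAt (Cn 2) p p) V W := rfl

section Derivative

variable {E : Type*} [NormedAddCommGroup E] [NormedSpace ℝ E]

/-- A tangent space is the model space seen through the preferred chart, so a manifold derivative is
the ordinary derivative of the map read in that chart. This is the only access to `mfderiv` of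
curves and parametrizations below. -/
lemma mfderiv_eq_fderiv_chartAt {f : E → BlowUp} {x : E}
    (hf : MDifferentiableAt 𝓘(ℝ, E) 𝓘(ℝ, Cn 2) f x) :
    (mfderiv 𝓘(ℝ, E) 𝓘(ℝ, Cn 2) f x : E →L[ℝ] Cn 2)
      = fderiv ℝ (chartAt (Cn 2) (f x) ∘ f) x := by
  rw [hf.mfderiv]
  simp only [writtenInExtChartAt, extChartAt, mfld_simps, fderivWithin_univ, chartAt_self_eq]
  rfl

lemma differentiableAt_ch_comp {f : E → BlowUp} {x : E}
    (hf : MDifferentiableAt 𝓘(ℝ, E) 𝓘(ℝ, Cn 2) f x) {a : Fin 2} (ha : f x ∈ (ch a).source) :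
    DifferentiableAt ℝ (ch a ∘ f) x :=
  ((mdifferentiableAt_atlas (I := 𝓘(ℝ, Cn 2)) (ch_mem_atlas a) ha).comp x hf).differentiableAt

/-- The derivative of the transition map `(u, v) ↦ (u v, 1 / v)`. -/
lemma fderiv_ch_rev_comp {f : E → BlowUp} {x : E}
    (hf : MDifferentiableAt 𝓘(ℝ, E) 𝓘(ℝ, Cn 2) f x) {a : Fin 2} (ha : f x ∈ (ch a).source)
    (hb : f x ∈ (ch a.rev).source) (v : E) :
    fderiv ℝ (ch a.rev ∘ f) x v =
      !₂[fderiv ℝ (ch a ∘ f) x v 0 * ch a (f x) 1 + ch a (f x) 0 * fderiv ℝ (ch a ∘ f) x v 1,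
        -(fderiv ℝ (ch a ∘ f) x v 1 * (ch a (f x) 1)⁻¹ ^ 2)] := by
  have hd := differentiableAt_ch_comp hf ha
  have hd' := differentiableAt_ch_comp hf hb
  have h1 : ch a (f x) 1 ≠ 0 := by
    rw [← ch_symm_mem_rev, (ch a).left_inv ha]
    exact hb
  have hev : ch a.rev ∘ f =ᶠ[nhds x]
      fun z => !₂[(ch a ∘ f) z 0 * (ch a ∘ f) z 1, ((ch a ∘ f) z 1)⁻¹] := by
    filter_upwards [hf.continuousAt ((ch a).open_source.mem_nhds ha)] with z hz
    rw [← ch_rev_symm, Function.comp_apply, Function.comp_apply, (ch a).left_inv hz]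
  have hk : ∀ k : Fin 2, HasFDerivAt (fun z => (ch a ∘ f) z k)
      (((EuclideanSpace.proj k : Cn 2 →L[ℂ] ℂ).restrictScalars ℝ).comp
        (fderiv ℝ (ch a ∘ f) x)) x := fun k =>
    ((EuclideanSpace.proj k : Cn 2 →L[ℂ] ℂ).restrictScalars ℝ).hasFDerivAt.comp x hd.hasFDerivAt
  have hk' : ∀ k : Fin 2, HasFDerivAt (fun z => (ch a.rev ∘ f) z k)
      (((EuclideanSpace.proj k : Cn 2 →L[ℂ] ℂ).restrictScalars ℝ).comp
        (fderiv ℝ (ch a.rev ∘ f) x)) x := fun k =>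
    ((EuclideanSpace.proj k : Cn 2 →L[ℂ] ℂ).restrictScalars ℝ).hasFDerivAt.comp x hd'.hasFDerivAt
  ext i
  fin_cases i
  · have h2 : HasFDerivAt (fun z => (ch a.rev ∘ f) z 0) _ x :=
      ((hk 0).mul (hk 1)).congr_of_eventuallyEq (by
        filter_upwards [hev] with z hz
        rw [hz]
        rfl)
    have h3 := congrArg (fun L => L v) ((hk' 0).unique h2)
    simp at h3 ⊢
    rw [h3]
    ring
  · have hi := ((hasStrictDerivAt_inv h1).hasDerivAt.hasFDerivAt.restrictScalars ℝ).comp x (hk 1)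
    have h2 : HasFDerivAt (fun z => (ch a.rev ∘ f) z 1) _ x :=
      hi.congr_of_eventuallyEq (by
        filter_upwards [hev] with z hz
        rw [hz]
        rfl)
    have h3 := congrArg (fun L => L v) ((hk' 1).unique h2)
    simp at h3 ⊢
    rw [h3]

/-- The Hermitian forms in terms of any of the two charts. -/
lemma herm_mfderiv {f : E → BlowUp} {x : E}
    (hf : MDifferentiableAt 𝓘(ℝ, E) 𝓘(ℝ, Cn 2) f x) {a : Fin 2} (ha : f x ∈ (ch a).source)
    (v w : E) :
    herm (f x) (mfderiv 𝓘(ℝ, E) 𝓘(ℝ, Cn 2) f x v) (mfderiv 𝓘(ℝ, E) 𝓘(ℝ, Cn 2) f x w)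
      = form (ch a (f x)) (fderiv ℝ (ch a ∘ f) x v) (fderiv ℝ (ch a ∘ f) x w) := by
  obtain ⟨b, hb⟩ := exists_chartAt_eq (f x)
  have hbs : f x ∈ (ch b).source := hb ▸ mem_chart_source (Cn 2) (f x)
  refine (herm_apply (f x) _ _).trans ?_
  rw [mfderiv_eq_fderiv_chartAt hf, hb]
  obtain rfl | rfl := eq_or_eq_rev a b
  · rfl
  · have h1 : ch a (f x) 1 ≠ 0 := by
      rw [← ch_symm_mem_rev, (ch a).left_inv ha]
      exact hbs
    have h2 : ch a.rev (f x) = !₂[ch a (f x) 0 * ch a (f x) 1, (ch a (f x) 1)⁻¹] := by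
      rw [← ch_rev_symm, (ch a).left_inv ha]
    refine Eq.trans ?_ (form_transition h1)
    rw [← h2]
    exact congrArg₂ (form (ch a.rev (f x))) (fderiv_ch_rev_comp hf ha hbs v)
      (fderiv_ch_rev_comp hf ha hbs w)

end Derivative

/-- Metric coefficients are defined with complex derivatives, while lengths and `herm_mfderiv` use
real ones; this links the two by restriction of scalars. -/
lemma mfderiv_complex_ch_symm (a : Fin 2) (y V : Cn 2) :
    (mfderiv 𝓘(ℂ, Cn 2) 𝓘(ℂ, Cn 2) (ch a).symm y V : Cn 2)
      = mfderiv 𝓘(ℝ, Cn 2) 𝓘(ℝ, Cn 2) (ch a).symm y V := by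
  have hf := mdifferentiableAt_atlas_symm (I := 𝓘(ℂ, Cn 2)) (ch_mem_atlas a) (Set.mem_univ y)
  have hfr := mdifferentiableAt_atlas_symm (I := 𝓘(ℝ, Cn 2)) (ch_mem_atlas a) (Set.mem_univ y)
  have h : (mfderiv 𝓘(ℂ, Cn 2) 𝓘(ℂ, Cn 2) (ch a).symm y : Cn 2 →L[ℂ] Cn 2)
      = fderiv ℂ (chartAt (Cn 2) ((ch a).symm y) ∘ (ch a).symm) y := by
    rw [hf.mfderiv]
    simp only [writtenInExtChartAt, extChartAt, mfld_simps, fderivWithin_univ, chartAt_self_eq]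
    rfl
  have hd : DifferentiableAt ℂ (chartAt (Cn 2) ((ch a).symm y) ∘ (ch a).symm) y :=
    ((mdifferentiableAt_atlas (I := 𝓘(ℂ, Cn 2)) (chart_mem_atlas _ _)
      (mem_chart_source _ _)).comp y hf).differentiableAt
  have h' := mfderiv_eq_fderiv_chartAt hfr
  exact (congrArg (fun L => L V) h).trans ((congrArg (fun L => L V)
    (hd.fderiv_restrictScalars ℝ)).symm.trans (congrArg (fun L => L V) h').symm)

/-- This is `herm_mfderiv` for the inverse chart, which reads as the identity in its own coordinates
even at points where that chart is not the preferred one. -/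
lemma hermCoeff_herm (a i j : Fin 2) : hermCoeff herm (ch a) i j = G i j := by
  ext y
  have hf := mdifferentiableAt_atlas_symm (I := 𝓘(ℝ, Cn 2)) (ch_mem_atlas a) (Set.mem_univ y)
  have h := herm_mfderiv hf (ch_symm_mem a y) (EuclideanSpace.single i (1 : ℂ))
    (EuclideanSpace.single j (1 : ℂ))
  have hid : ch a ∘ (ch a).symm = id := funext fun z => ch_right_inv a z
  rw [hid, fderiv_id, ch_right_inv] at h
  rw [← form_single]
  refine Eq.trans ?_ h
  rw [hermCoeff]
  exact congrArg₂ (fun V W : Cn 2 => herm ((ch a).symm y) V W) (mfderiv_complex_ch_symm a y _)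
    (mfderiv_complex_ch_symm a y _)

/-- The Simanca metric. -/
def simanca : KahlerMetric 2 BlowUp where
  herm := herm
  herm_symm p V W := star_form _ V W
  herm_pos p V hV := form_pos _ V hV
  smooth e he i j := by
    obtain ⟨a, rfl⟩ := (mem_atlas_iff e).1 he
    rw [hermCoeff_herm]
    exact (contDiff_G i j).contDiffOn
  closed e he y _ i j k := by
    obtain ⟨a, rfl⟩ := (mem_atlas_iff e).1 he
    rw [hermCoeff_herm, hermCoeff_herm, wirt_G, wirt_G]
    fin_cases i <;> fin_cases j <;> fin_cases k <;> rfl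

end BlowUp

/-! ### Uniqueness of the Simanca metric and its pointwise curvature properties. -/

namespace BlowUp
open Simanca

lemma ddbar_congr {n : ℕ} {φ ψ : Cn n → ℝ} {x : Cn n} (h : φ =ᶠ[nhds x] ψ) (i j : Fin n) :
    ddbar φ i j x = ddbar ψ i j x := by
  refine wirt_congr i ?_
  filter_upwards [h.eventually_nhds] with y hy
  refine wirtBar_congr j ?_
  filter_upwards [hy] with z hz
  rw [hz]

lemma radial_ch_symm {a : Fin 2} {y : Cn 2} (hy : y 0 ≠ 0) :
    radial (fun x => x + Real.log x) ((ch a).symm y) = pot y + 1 * Real.log (‖y 0‖ ^ 2) := by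
  have h0 : ‖y 0‖ ^ 2 ≠ 0 := by positivity
  rw [radial, norm_sq_blowDown_ch_symm, pot, Real.log_mul h0 (one_add_norm_sq_ne y 1)]
  ring

lemma continuous_coord (k : Fin 2) : Continuous fun y : Cn 2 => y k :=
  (contDiff_coord k).continuous

lemma ddbar_radial {a : Fin 2} {y : Cn 2} (hy : y 0 ≠ 0) (i j : Fin 2) :
    ddbar (radial (fun x => x + Real.log x) ∘ (ch a).symm) i j y = G i j y := by
  rw [← ddbar_pot_add 1 0 i j hy]
  refine ddbar_congr ?_ i j
  filter_upwards [(continuous_coord 0).continuousAt.eventually_ne hy] with z hz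
  exact radial_ch_symm hz

lemma contDiff_blowDown_ch_symm (a : Fin 2) :
    ContDiff ℂ ω fun y => blowDown ((ch a).symm y) := by
  rw [contDiff_euclidean]
  intro i
  simp only [blowDown_ch_symm, PiLp.smul_apply, smul_eq_mul]
  exact ((EuclideanSpace.proj 0 : Cn 2 →L[ℂ] ℂ).contDiff).mul (contDiff_dir a i)

lemma contMDiff_blowDown : ContMDiff 𝓘(ℝ, Cn 2) 𝓘(ℝ, Cn 2) ω blowDown := by
  intro p
  obtain ⟨a, ha⟩ := exists_chartAt_eq p
  exact contMDiffAt_of_ch (ha ▸ mem_chart_source (Cn 2) p)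
    ((contDiff_blowDown_ch_symm a).restrict_scalars ℝ).contDiffAt

lemma contMDiffOn_radial {f : ℝ → ℝ} (hf : ∀ x, 0 < x → ContDiffAt ℝ ∞ f x) :
    ContMDiffOn 𝓘(ℝ, Cn 2) 𝓘(ℝ) ∞ (radial f) offE := by
  intro p hp
  have hp' : 0 < ‖blowDown p‖ ^ 2 := by
    have : blowDown p ≠ 0 := hp
    positivity
  have h1 : ContMDiffAt 𝓘(ℝ, Cn 2) 𝓘(ℝ, Cn 2) ∞ blowDown p :=
    contMDiff_blowDown.contMDiffAt.of_le le_top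
  have h2 : ContDiffAt ℝ ∞ (fun z : Cn 2 => ‖z‖ ^ 2) (blowDown p) := contDiffAt_id.norm_sq ℝ
  exact ((hf _ hp').contMDiffAt.comp p (h2.contMDiffAt.comp p h1)).contMDiffWithinAt

lemma isSimanca_simanca : IsSimanca simanca := by
  constructor
  · exact contMDiffOn_radial fun x hx => contDiffAt_id.add (Real.contDiffAt_log.2 hx.ne')
  · intro e he y _ hy i j
    obtain ⟨a, rfl⟩ := (mem_atlas_iff e).1 he
    rw [ddbar_radial ((ch_symm_mem_offE a y).1 hy)]
    exact congrFun (hermCoeff_herm a i j) y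

lemma dense_coord_ne (k : Fin 2) : Dense {y : Cn 2 | y k ≠ 0} := by
  have hopen : IsOpenMap (EuclideanSpace.proj k : Cn 2 →L[ℂ] ℂ) :=
    (EuclideanSpace.proj k : Cn 2 →L[ℂ] ℂ).isOpenMap fun c => ⟨EuclideanSpace.single k c, by simp⟩
  exact (dense_compl_singleton (0 : ℂ)).preimage hopen

/-- The potential fixes the coefficients where `u ≠ 0`; this set is dense and both sides are
continuous, so they also agree on the exceptional divisor. -/
lemma IsSimanca.coeff_eq {g : KahlerMetric 2 BlowUp} (hg : IsSimanca g) (a i j : Fin 2) :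
    g.coeff (ch a) i j = G i j := by
  have h1 : Continuous (g.coeff (ch a) i j) :=
    (contDiffOn_univ.1 (g.smooth (ch a) (ch_mem_atlas a) i j)).continuous
  refine h1.ext_on (dense_coord_ne 0) (contDiff_G i j).continuous fun y hy => ?_
  rw [hg.2 (ch a) (ch_mem_atlas a) y (Set.mem_univ y) ((ch_symm_mem_offE a y).2 hy) i j,
    ddbar_radial hy]

lemma mfderiv_ch_symm_of_chartAt {a : Fin 2} {y : Cn 2}
    (h : chartAt (Cn 2) ((ch a).symm y) = ch a) (V : Cn 2) :
    (mfderiv 𝓘(ℂ, Cn 2) 𝓘(ℂ, Cn 2) (ch a).symm y V : Cn 2) = V := by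
  rw [mfderiv_complex_ch_symm]
  have hf := mdifferentiableAt_atlas_symm (I := 𝓘(ℝ, Cn 2)) (ch_mem_atlas a) (Set.mem_univ y)
  have hid : ch a ∘ (ch a).symm = id := funext fun z => ch_right_inv a z
  refine (congrArg (fun L => L V) (mfderiv_eq_fderiv_chartAt hf)).trans ?_
  rw [h, hid, fderiv_id]
  rfl

/-- Where `ch a` is the preferred chart, its inverse has the identity as derivative, so the
coefficients recover the form itself on the standard basis. -/
lemma hermCoeff_of_chartAt
    (h : ∀ x : BlowUp, TangentSpace 𝓘(ℂ, Cn 2) x →ₗ[ℂ] TangentSpace 𝓘(ℂ, Cn 2) x →ₗ⋆[ℂ] ℂ)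
    {a : Fin 2} {y : Cn 2} {p : BlowUp} (hp : (ch a).symm y = p)
    (ha : chartAt (Cn 2) p = ch a) (i j : Fin 2) :
    hermCoeff h (ch a) i j y
      = h p (EuclideanSpace.single i (1 : ℂ) : Cn 2) (EuclideanSpace.single j (1 : ℂ) : Cn 2) := by
  subst hp
  exact congrArg₂ (fun V W : Cn 2 => h ((ch a).symm y) V W) (mfderiv_ch_symm_of_chartAt ha _)
    (mfderiv_ch_symm_of_chartAt ha _)

lemma sesquilin_ext {A B : Cn 2 →ₗ[ℂ] Cn 2 →ₗ⋆[ℂ] ℂ}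
    (h : ∀ i j, A (EuclideanSpace.single i 1) (EuclideanSpace.single j 1)
      = B (EuclideanSpace.single i 1) (EuclideanSpace.single j 1)) : A = B := by
  refine (EuclideanSpace.basisFun (Fin 2) ℂ).toBasis.ext fun i => ?_
  refine (EuclideanSpace.basisFun (Fin 2) ℂ).toBasis.ext fun j => ?_
  simpa using h i j

lemma IsSimanca.eq_simanca {g : KahlerMetric 2 BlowUp} (hg : IsSimanca g) : g = simanca := by
  have h : g.herm = herm := by
    funext p
    obtain ⟨a, ha⟩ := exists_chartAt_eq p
    have hp : (ch a).symm (ch a p) = p := (ch a).left_inv (ha ▸ mem_chart_source (Cn 2) p)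
    refine sesquilin_ext fun i j => ?_
    refine (hermCoeff_of_chartAt g.herm hp ha i j).symm.trans
      (Eq.trans ?_ (hermCoeff_of_chartAt herm hp ha i j))
    rw [hermCoeff_herm]
    exact congrFun (hg.coeff_eq a i j) _
  cases g
  cases h
  rfl

lemma isRadial_simanca : IsRadial simanca := ⟨_, isSimanca_simanca⟩

/-- Both charts give the same functions `G`, so one computation in coordinates settles the curvature
at every point. -/
lemma simanca_coeff (a : Fin 2) : simanca.coeff (ch a) = G := by
  funext i j
  exact hermCoeff_herm a i j

lemma simanca_coeff_chartAt (p : BlowUp) : simanca.coeff (chartAt (Cn 2) p) = G := by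
  obtain ⟨a, ha⟩ := exists_chartAt_eq p
  rw [ha, simanca_coeff]

lemma isScalarFlat_simanca : simanca.IsScalarFlat := by
  intro p
  rw [KahlerMetric.scalarCurvature, simanca_coeff_chartAt, scal_G]

lemma not_isRicciFlat_simanca : ¬ simanca.IsRicciFlat := by
  intro h
  have h0 := h ((ch 0).symm 0) 0 0
  rw [simanca_coeff_chartAt] at h0
  exact ric_G_ne_zero _ h0

lemma a3_simanca (p : BlowUp) : simanca.a3 p = 0 := by
  rw [KahlerMetric.a3, simanca_coeff_chartAt, tyz3_G]

end BlowUp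

namespace BlowUp
open Simanca

/-! ### Completeness -/

lemma norm_sq_eq_rev (a : Fin 2) (z : Cn 2) : ‖z‖ ^ 2 = ‖z a‖ ^ 2 + ‖z a.rev‖ ^ 2 := by
  rw [EuclideanSpace.norm_sq_eq, Fin.sum_univ_two]
  fin_cases a
  · rfl
  · simp [add_comm, Fin.rev]

section Derivative

variable {E : Type*} [NormedAddCommGroup E] [NormedSpace ℝ E]

lemma fderiv_coord {f : E → Cn 2} {x : E} (hf : DifferentiableAt ℝ f x) (k : Fin 2) :
    HasFDerivAt (fun z => f z k)
      (((EuclideanSpace.proj k : Cn 2 →L[ℂ] ℂ).restrictScalars ℝ).comp (fderiv ℝ f x)) x :=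
  ((EuclideanSpace.proj k : Cn 2 →L[ℂ] ℂ).restrictScalars ℝ).hasFDerivAt.comp x hf.hasFDerivAt

lemma blowDown_apply_of_mem {a : Fin 2} {p : BlowUp} (hp : p ∈ (ch a).source) :
    blowDown p a = ch a p 0 ∧ blowDown p a.rev = ch a p 0 * ch a p 1 := by
  have h := blowDown_ch_symm a (ch a p)
  rw [(ch a).left_inv hp] at h
  rw [h]
  simp

lemma differentiableAt_blowDown_comp {f : E → BlowUp} {x : E}
    (hf : MDifferentiableAt 𝓘(ℝ, E) 𝓘(ℝ, Cn 2) f x) : DifferentiableAt ℝ (blowDown ∘ f) x :=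
  ((contMDiff_blowDown.mdifferentiable (by simp) (f x)).comp x hf).differentiableAt

lemma fderiv_blowDown_comp {f : E → BlowUp} {x : E}
    (hf : MDifferentiableAt 𝓘(ℝ, E) 𝓘(ℝ, Cn 2) f x) {a : Fin 2} (ha : f x ∈ (ch a).source) (v : E) :
    fderiv ℝ (blowDown ∘ f) x v a = fderiv ℝ (ch a ∘ f) x v 0 ∧
    fderiv ℝ (blowDown ∘ f) x v a.rev = ch a (f x) 1 * fderiv ℝ (ch a ∘ f) x v 0
      + ch a (f x) 0 * fderiv ℝ (ch a ∘ f) x v 1 := by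
  have hd := differentiableAt_ch_comp hf ha
  have hb := differentiableAt_blowDown_comp hf
  have hev := hf.continuousAt ((ch a).open_source.mem_nhds ha)
  have h0 : HasFDerivAt (fun z => (blowDown ∘ f) z a) _ x :=
    (fderiv_coord hd 0).congr_of_eventuallyEq (by
      filter_upwards [hev] with z hz
      exact (blowDown_apply_of_mem hz).1)
  have h1 : HasFDerivAt (fun z => (blowDown ∘ f) z a.rev) _ x :=
    ((fderiv_coord hd 0).mul (fderiv_coord hd 1)).congr_of_eventuallyEq (by
      filter_upwards [hev] with z hz
      exact (blowDown_apply_of_mem hz).2)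
  have e0 := congrArg (fun L => L v) ((fderiv_coord hb a).unique h0)
  have e1 := congrArg (fun L => L v) ((fderiv_coord hb a.rev).unique h1)
  simp at e0 e1
  refine ⟨e0, e1.trans ?_⟩
  ring

lemma riemannian_mfderiv {f : E → BlowUp} {x : E}
    (hf : MDifferentiableAt 𝓘(ℝ, E) 𝓘(ℝ, Cn 2) f x) {a : Fin 2} (ha : f x ∈ (ch a).source) (v w : E) :
    simanca.riemannian (f x) (mfderiv 𝓘(ℝ, E) 𝓘(ℝ, Cn 2) f x v)
      (mfderiv 𝓘(ℝ, E) 𝓘(ℝ, Cn 2) f x w)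
      = (form (ch a (f x)) (fderiv ℝ (ch a ∘ f) x v) (fderiv ℝ (ch a ∘ f) x w)).re :=
  congrArg Complex.re (herm_mfderiv hf ha v w)

/-- The blow-down map does not increase lengths. -/
lemma norm_sq_fderiv_blowDown_le {f : E → BlowUp} {x : E}
    (hf : MDifferentiableAt 𝓘(ℝ, E) 𝓘(ℝ, Cn 2) f x) (v : E) :
    ‖fderiv ℝ (blowDown ∘ f) x v‖ ^ 2 ≤
      simanca.riemannian (f x) (mfderiv 𝓘(ℝ, E) 𝓘(ℝ, Cn 2) f x v)
        (mfderiv 𝓘(ℝ, E) 𝓘(ℝ, Cn 2) f x v) := by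
  obtain ⟨a, ha⟩ := exists_chartAt_eq (f x)
  have has : f x ∈ (ch a).source := ha ▸ mem_chart_source (Cn 2) (f x)
  obtain ⟨h0, h1⟩ := fderiv_blowDown_comp hf has v
  rw [riemannian_mfderiv hf has, form_self_re, norm_sq_eq_rev a, h0, h1]
  have : 0 ≤ ((1 + ‖ch a (f x) 1‖ ^ 2)⁻¹) ^ 2 * ‖fderiv ℝ (ch a ∘ f) x v 1‖ ^ 2 := by positivity
  linarith

end Derivative

/-- The norm of tangent vectors for the Simanca metric. -/
@[reducible] def tangentENorm (p : BlowUp) : ENorm (TangentSpace 𝓘(ℝ, Cn 2) p) :=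
  ⟨fun v => ENNReal.ofReal (Real.sqrt (simanca.riemannian p v v))⟩

attribute [local instance] tangentENorm

lemma tangentENorm_def (p : BlowUp) (v : TangentSpace 𝓘(ℝ, Cn 2) p) :
    ‖v‖ₑ = ENNReal.ofReal (Real.sqrt (simanca.riemannian p v v)) := rfl

lemma form_real_smul (y V : Cn 2) (r : ℝ) : (form y (r • V) (r • V)).re = r ^ 2 * (form y V V).re := by
  have h : r • V = (r : ℂ) • V := by
    ext i
    simp
  rw [h, form_smul_left, form_smul_right]
  simp
  ring

/-- Homogeneity makes length invariant under reparametrization, as the concatenation of curves in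
`riemDist_triangle` requires. -/
lemma enormSMulClass_tangent (p : BlowUp) : ENormSMulClass ℝ (TangentSpace 𝓘(ℝ, Cn 2) p) where
  enorm_smul r v := by
    rw [tangentENorm_def, tangentENorm_def]
    have h : simanca.riemannian p (r • v) (r • v) = r ^ 2 * simanca.riemannian p v v :=
      form_real_smul _ v r
    rw [h, Real.sqrt_mul (sq_nonneg r), Real.sqrt_sq_eq_abs, ENNReal.ofReal_mul (abs_nonneg r),
      ← Real.norm_eq_abs, ofReal_norm]

attribute [local instance] enormSMulClass_tangent

lemma riemDist_eq (x y : BlowUp) :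
    simanca.riemDist x y = Manifold.riemannianEDist 𝓘(ℝ, Cn 2) x y := rfl

lemma riemDist_triangle (x y z : BlowUp) :
    simanca.riemDist x z ≤ simanca.riemDist x y + simanca.riemDist y z := by
  simp only [riemDist_eq]
  exact Manifold.riemannianEDist_triangle

open MeasureTheory Set in
-- A curve joining `x` to `y` projects to a curve in `ℂ²` that is no longer than it, by
-- `norm_sq_fderiv_blowDown_le`.
lemma edist_blowDown_le (x y : BlowUp) :
    edist (blowDown x) (blowDown y) ≤ simanca.riemDist x y := by
  rw [riemDist_eq]
  refine le_of_forall_gt fun r hr => ?_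
  obtain ⟨γ, h0, h1, hγ, hr⟩ := Manifold.exists_lt_of_riemannianEDist_lt hr
  refine lt_of_le_of_lt ?_ hr
  have hc : ContDiffOn ℝ 1 (blowDown ∘ γ) (Icc 0 1) :=
    contMDiffOn_iff_contDiffOn.1 ((contMDiff_blowDown.of_le le_top).comp_contMDiffOn hγ)
  rw [edist_comm, edist_eq_enorm_sub, ← h0, ← h1]
  refine (enorm_sub_le_lintegral_derivWithin_Icc_of_contDiffOn_Icc hc zero_le_one).trans ?_
  -- Dropping the endpoints leaves only parameters at which `γ` has a two-sided derivative.
  rw [Manifold.pathELength_eq_lintegral_mfderiv_Ioo, ← restrict_Ioo_eq_restrict_Icc]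
  refine setLIntegral_mono' measurableSet_Ioo fun t ht => ?_
  have hnhds : Icc (0 : ℝ) 1 ∈ nhds t := Icc_mem_nhds ht.1 ht.2
  have hd : MDifferentiableAt 𝓘(ℝ, ℝ) 𝓘(ℝ, Cn 2) γ t :=
    (hγ.contMDiffAt hnhds).mdifferentiableAt one_ne_zero
  rw [derivWithin_of_mem_nhds hnhds, tangentENorm_def, ← ofReal_norm]
  refine ENNReal.ofReal_le_ofReal (Real.le_sqrt_of_sq_le ?_)
  exact norm_sq_fderiv_blowDown_le hd (1 : ℝ)

/-- In the constant, `1` comes from `V 0`, `4 R² = (2 R)²` from the second component of the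
blow-down, and `1` from the Fubini-Study term. -/
lemma form_self_re_le {y : Cn 2} {R : ℝ} (h0 : ‖y 0‖ ≤ R) (h1 : ‖y 1‖ ≤ R) (V : Cn 2) :
    (form y V V).re ≤ (2 + 4 * R ^ 2) * ‖V‖ ^ 2 := by
  rw [form_self_re]
  have hV0 : ‖V 0‖ ≤ ‖V‖ := PiLp.norm_apply_le V 0
  have hV1 : ‖V 1‖ ≤ ‖V‖ := PiLp.norm_apply_le V 1
  have hR : 0 ≤ R := (norm_nonneg _).trans h0
  have h2 : ‖y 1 * V 0 + y 0 * V 1‖ ≤ 2 * R * ‖V‖ := by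
    refine (norm_add_le _ _).trans ?_
    rw [norm_mul, norm_mul]
    have e1 : ‖y 1‖ * ‖V 0‖ ≤ R * ‖V‖ := mul_le_mul h1 hV0 (norm_nonneg _) hR
    have e2 : ‖y 0‖ * ‖V 1‖ ≤ R * ‖V‖ := mul_le_mul h0 hV1 (norm_nonneg _) hR
    linarith
  have h3 : ((1 + ‖y 1‖ ^ 2)⁻¹) ^ 2 ≤ 1 := by
    refine pow_le_one₀ (by positivity) (inv_le_one_of_one_le₀ ?_)
    have := sq_nonneg ‖y 1‖
    linarith
  have e1 : ‖V 0‖ ^ 2 ≤ ‖V‖ ^ 2 := pow_le_pow_left₀ (norm_nonneg _) hV0 2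
  have e2 : ‖y 1 * V 0 + y 0 * V 1‖ ^ 2 ≤ (2 * R * ‖V‖) ^ 2 := pow_le_pow_left₀ (norm_nonneg _) h2 2
  have e3 : ((1 + ‖y 1‖ ^ 2)⁻¹) ^ 2 * ‖V 1‖ ^ 2 ≤ 1 * ‖V‖ ^ 2 :=
    mul_le_mul h3 (pow_le_pow_left₀ (norm_nonneg _) hV1 2) (by positivity) zero_le_one
  nlinarith

open MeasureTheory Set in
/-- On bounded sets of the coordinates, the Riemannian distance is controlled by the Euclidean
one. -/
lemma riemDist_ch_symm_le (a : Fin 2) {R : ℝ} {y z : Cn 2} (hy : ‖y‖ ≤ R) (hz : ‖z‖ ≤ R) :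
    simanca.riemDist ((ch a).symm y) ((ch a).symm z)
      ≤ ENNReal.ofReal (Real.sqrt ((2 + 4 * R ^ 2) * ‖z - y‖ ^ 2)) := by
  rw [riemDist_eq]
  -- The straight segment in coordinates is the test curve; by convexity it stays in the ball of
  -- radius `R`.
  set η : ℝ →ᴬ[ℝ] Cn 2 := ContinuousAffineMap.lineMap y z with hη
  have hγ : ContMDiff 𝓘(ℝ, ℝ) 𝓘(ℝ, Cn 2) 1 ((ch a).symm ∘ η) :=
    ((contMDiff_ch_symm a).of_le le_top).comp (η.contDiff.contMDiff)
  have hle := Manifold.riemannianEDist_le_pathELength (a := 0) (b := 1)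
    (x := (ch a).symm y) (y := (ch a).symm z) hγ.contMDiffOn
    (by simp [hη, ContinuousAffineMap.coe_lineMap_eq])
    (by simp [hη, ContinuousAffineMap.coe_lineMap_eq]) zero_le_one
  refine hle.trans ?_
  rw [Manifold.pathELength_eq_lintegral_mfderiv_Icc]
  have hbound : ∀ t ∈ Icc (0 : ℝ) 1, ‖mfderiv 𝓘(ℝ, ℝ) 𝓘(ℝ, Cn 2) ((ch a).symm ∘ η) t 1‖ₑ
      ≤ ENNReal.ofReal (Real.sqrt ((2 + 4 * R ^ 2) * ‖z - y‖ ^ 2)) := by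
    intro t ht
    have hd : MDifferentiableAt 𝓘(ℝ, ℝ) 𝓘(ℝ, Cn 2) ((ch a).symm ∘ η) t :=
      (hγ t).mdifferentiableAt one_ne_zero
    have hηt : ‖η t‖ ≤ R := by
      have hconv := convex_closedBall (0 : Cn 2) R
      have hmem := hconv.lineMap_mem (mem_closedBall_zero_iff.2 hy) (mem_closedBall_zero_iff.2 hz) ht
      exact mem_closedBall_zero_iff.1 hmem
    have hcomp : ch a ∘ ((ch a).symm ∘ η) = η := funext fun s => ch_right_inv a _
    rw [tangentENorm_def]
    refine ENNReal.ofReal_le_ofReal (Real.sqrt_le_sqrt ?_)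
    refine (riemannian_mfderiv hd (ch_symm_mem a _) (1 : ℝ) (1 : ℝ)).trans_le ?_
    rw [hcomp, Function.comp_apply, ch_right_inv]
    have hfd : fderiv ℝ η t (1 : ℝ) = z - y := by simp [hη]
    rw [hfd]
    exact form_self_re_le ((PiLp.norm_apply_le _ 0).trans hηt) ((PiLp.norm_apply_le _ 1).trans hηt) _
  refine (setLIntegral_mono' measurableSet_Icc hbound).trans ?_
  simp

/-- Use the chart of the larger homogeneous coordinate of the line. The bound on the slope makes
bounded sets of `ℂ²` lift to bounded sets of coordinates. -/
lemma exists_ch_slope_le_one (p : BlowUp) : ∃ a, p ∈ (ch a).source ∧ ‖ch a p 1‖ ≤ 1 := by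
  have key : ∀ a : Fin 2, p.1.2.rep a ≠ 0 → ‖p.1.2.rep a.rev‖ ≤ ‖p.1.2.rep a‖ →
      ∃ a, p ∈ (ch a).source ∧ ‖ch a p 1‖ ≤ 1 := by
    intro a ha hle
    refine ⟨a, ha, ?_⟩
    change ‖p.1.2.rep a.rev / p.1.2.rep a‖ ≤ 1
    rw [norm_div]
    exact div_le_one_of_le₀ hle (norm_nonneg _)
  rcases le_total ‖p.1.2.rep 1‖ ‖p.1.2.rep 0‖ with h | h
  · refine key 0 (fun h0 => rep_one_ne_zero p (not_not.2 h0) ?_) h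
    rw [h0, norm_zero] at h
    exact norm_le_zero_iff.1 h
  · refine key 1 (fun h1 => ?_) h
    by_cases h0 : p.1.2.rep 0 = 0
    · exact rep_one_ne_zero p (not_not.2 h0) h1
    · rw [h1, norm_zero] at h
      exact h0 (norm_le_zero_iff.1 h)

open Filter Topology in
-- The image in `ℂ²` of a Cauchy sequence is bounded, so a subsequence stays in a compact set of
-- coordinates of one chart. A limit point there is a limit for the Riemannian distance by
-- `riemDist_ch_symm_le`, and a Cauchy sequence converges as soon as a subsequence does.
lemma isComplete_simanca : simanca.IsComplete := by
  intro u hu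
  have hcs : CauchySeq fun n => blowDown (u n) := by
    refine EMetric.cauchySeq_iff.2 fun ε hε => ?_
    obtain ⟨N, hN⟩ := hu ε hε
    exact ⟨N, fun m hm k hk => (edist_blowDown_le _ _).trans_lt (hN m hm k hk)⟩
  obtain ⟨R, hR⟩ := hcs.isBounded_range.exists_norm_le
  have hR' : ∀ n, ‖blowDown (u n)‖ ≤ R := fun n => hR _ ⟨n, rfl⟩
  -- Pigeonhole: one of the two charts serves infinitely many terms.
  have hfreq : ∃ a, ∃ᶠ n in atTop, u n ∈ (ch a).source ∧ ‖ch a (u n) 1‖ ≤ 1 := by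
    by_contra hcon
    push Not at hcon
    obtain ⟨n, h0, h1⟩ := ((hcon 0).and (hcon 1)).exists
    obtain ⟨a, ha, ha'⟩ := exists_ch_slope_le_one (u n)
    fin_cases a
    · exact absurd ha' (not_le.2 (h0 ha))
    · exact absurd ha' (not_le.2 (h1 ha))
  obtain ⟨a, ha⟩ := hfreq
  obtain ⟨φ, hφ, hφa⟩ := extraction_of_frequently_atTop ha
  -- `|u| ≤ R` because `u` is a coordinate of the blow-down, `|v| ≤ 1` by the choice of chart, and
  -- `R² + 1 ≤ (R + 1)²`.
  have hbd : ∀ n, ‖ch a (u (φ n))‖ ≤ R + 1 := by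
    intro n
    obtain ⟨hs, hle⟩ := hφa n
    have h0 : ‖ch a (u (φ n)) 0‖ ≤ R := by
      rw [← (blowDown_apply_of_mem hs).1]
      exact (PiLp.norm_apply_le _ a).trans (hR' _)
    have hR0 : 0 ≤ R := (norm_nonneg _).trans h0
    refine le_of_sq_le_sq ?_ (by positivity)
    rw [EuclideanSpace.norm_sq_eq, Fin.sum_univ_two]
    have e1 := pow_le_pow_left₀ (norm_nonneg _) h0 2
    have e2 := pow_le_pow_left₀ (norm_nonneg _) hle 2
    nlinarith
  obtain ⟨y, hy, ψ, hψ, hlim⟩ := (ProperSpace.isCompact_closedBall (0 : Cn 2) (R + 1)).tendsto_subseq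
    fun n => mem_closedBall_zero_iff.2 (hbd n)
  refine ⟨(ch a).symm y, ?_⟩
  have hy' : ‖y‖ ≤ R + 1 := mem_closedBall_zero_iff.1 hy
  have hsub : Tendsto (fun n => simanca.riemDist (u (φ (ψ n))) ((ch a).symm y)) atTop (𝓝 0) := by
    have hle : ∀ n, simanca.riemDist (u (φ (ψ n))) ((ch a).symm y) ≤
        ENNReal.ofReal (Real.sqrt ((2 + 4 * (R + 1) ^ 2) * ‖y - ch a (u (φ (ψ n)))‖ ^ 2)) := by
      intro n
      have h := riemDist_ch_symm_le a (hbd (ψ n)) hy'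
      rwa [(ch a).left_inv (hφa (ψ n)).1] at h
    refine tendsto_of_tendsto_of_tendsto_of_le_of_le tendsto_const_nhds ?_ (fun _ => zero_le) hle
    have h1 : Tendsto (fun n => ‖y - ch a (u (φ (ψ n)))‖) atTop (𝓝 0) := by
      have := (tendsto_const_nhds (x := y)).sub hlim
      simpa using this.norm
    have h2 := ((h1.pow 2).const_mul (2 + 4 * (R + 1) ^ 2)).sqrt
    have h3 := ENNReal.tendsto_ofReal h2
    simpa using h3
  refine ENNReal.tendsto_nhds_zero.2 fun ε hε => ?_
  obtain ⟨N, hN⟩ := hu (ε / 2) (ENNReal.half_pos hε.ne')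
  filter_upwards [eventually_ge_atTop N] with k hk
  obtain ⟨n, hn1, hn2⟩ := ((ENNReal.tendsto_nhds_zero.1 hsub (ε / 2) (ENNReal.half_pos hε.ne')).and
    ((hφ.comp hψ).tendsto_atTop.eventually (eventually_ge_atTop N))).exists
  calc simanca.riemDist (u k) ((ch a).symm y)
      ≤ simanca.riemDist (u k) (u (φ (ψ n))) + simanca.riemDist (u (φ (ψ n))) ((ch a).symm y) :=
        riemDist_triangle _ _ _
    _ ≤ ε / 2 + ε / 2 := add_le_add (hN k hk _ hn2).le hn1
    _ = ε := ENNReal.add_halves ε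

end BlowUp

/-! ### Derivatives of homogeneous functions -/

/-- The function is homogeneous of degree `-m`. Rescaling by `t = 1 / ‖x‖` moves `x` to the unit
sphere, where compactness bounds the `k`-th derivative; the chain rule for the dilation contributes
`t ^ k` to the factor `t ^ m`. -/
lemma exists_norm_iteratedFDeriv_le_of_homogeneous {E : Type*} [NormedAddCommGroup E]
    [NormedSpace ℝ E] [ProperSpace E] {f : E → ℝ} (m : ℕ)
    (hf : ∀ x, x ≠ 0 → ContDiffAt ℝ ∞ f x)
    (hom : ∀ t : ℝ, 0 < t → ∀ x, f x = t ^ m * f (t • x)) (k : ℕ) :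
    ∃ C : ℝ, ∀ x, x ≠ 0 → ‖iteratedFDeriv ℝ k f x‖ ≤ C * (‖x‖⁻¹) ^ (m + k) := by
  have hcont : ContinuousOn (fun x => ‖iteratedFDeriv ℝ k f x‖) (Metric.sphere (0 : E) 1) := by
    intro x hx
    have hx0 : x ≠ 0 := ne_zero_of_mem_unit_sphere ⟨x, hx⟩
    exact ((hf x hx0).continuousAt_iteratedFDeriv
      (by exact_mod_cast le_top)).norm.continuousWithinAt
  obtain ⟨C, hC⟩ := (isCompact_sphere (0 : E) 1).exists_bound_of_continuousOn hcont
  refine ⟨C, fun x hx => ?_⟩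
  have hx' : ‖x‖ ≠ 0 := norm_ne_zero_iff.2 hx
  have ht : 0 < ‖x‖⁻¹ := by positivity
  set t := ‖x‖⁻¹ with ht_def
  let g : E ≃L[ℝ] E := ContinuousLinearEquiv.smulLeft (Units.mk0 t ht.ne')
  have hg : ∀ y, g y = t • y := fun y => rfl
  have hsx : t • x ∈ Metric.sphere (0 : E) 1 := by
    rw [mem_sphere_zero_iff_norm, norm_smul, Real.norm_of_nonneg ht.le, ht_def,
      inv_mul_cancel₀ hx']
  have hsx0 : t • x ≠ 0 := smul_ne_zero ht.ne' hx
  have hfg : f = t ^ m • (f ∘ g) := funext fun y => hom t ht y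
  have hcd : ContDiffAt ℝ k (f ∘ g) x :=
    ((hf (t • x) hsx0).of_le (by exact_mod_cast le_top)).comp x
      (g.contDiff.contDiffAt.of_le le_top)
  have h1 : iteratedFDeriv ℝ k f x
      = t ^ m • (iteratedFDeriv ℝ k f (t • x)).compContinuousLinearMap fun _ => (g : E →L[ℝ] E) := by
    conv_lhs => rw [hfg]
    rw [iteratedFDeriv_const_smul_apply hcd]
    congr 1
    have := g.iteratedFDerivWithin_comp_right f uniqueDiffOn_univ (x := x) (Set.mem_univ _) k
    simpa only [Set.preimage_univ, iteratedFDerivWithin_univ, hg] using this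
  have hgn : ‖(g : E →L[ℝ] E)‖ ≤ t := by
    refine ContinuousLinearMap.opNorm_le_bound _ ht.le fun y => ?_
    rw [ContinuousLinearEquiv.coe_coe, hg, norm_smul, Real.norm_of_nonneg ht.le]
  rw [h1, norm_smul, Real.norm_of_nonneg (pow_nonneg ht.le m)]
  have h2 := ContinuousMultilinearMap.norm_compContinuousLinearMap_le
    (iteratedFDeriv ℝ k f (t • x)) (fun _ => (g : E →L[ℝ] E))
  rw [Finset.prod_const, Finset.card_univ, Fintype.card_fin] at h2
  have hC' : ‖iteratedFDeriv ℝ k f (t • x)‖ ≤ C := by simpa using hC _ hsx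
  calc t ^ m * ‖(iteratedFDeriv ℝ k f (t • x)).compContinuousLinearMap fun _ => (g : E →L[ℝ] E)‖
      ≤ t ^ m * (‖iteratedFDeriv ℝ k f (t • x)‖ * ‖(g : E →L[ℝ] E)‖ ^ k) := by gcongr
    _ ≤ t ^ m * (C * t ^ k) := by
        have := (norm_nonneg _).trans hC'
        gcongr
    _ = C * t ^ (m + k) := by ring

namespace BlowUp
open Simanca

/-! ### The Simanca metric is asymptotically Euclidean -/

/-- The point of the blow-up over a nonzero vector. -/
def pointOver (z : Cn 2) (h : z ≠ 0) : BlowUp :=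
  ⟨(z, Projectivization.mk ℂ z h), by
    rw [Projectivization.submodule_mk]
    exact Submodule.mem_span_singleton_self _⟩

open Classical in
/-- The inverse of the blow-down map off the exceptional divisor. -/
def psi (z : Cn 2) : BlowUp := if h : z = 0 then (ch 0).symm 0 else pointOver z h

/-- The default value of `psi` at `0` is a point over `0`, so the identity holds without exception
and can be differentiated everywhere. -/
lemma blowDown_psi (z : Cn 2) : blowDown (psi z) = z := by
  by_cases h : z = 0
  · rw [psi, dif_pos h, blowDown_ch_symm, h]
    simp
  · rw [psi, dif_neg h]
    rfl

lemma psi_eq_ch_symm {a : Fin 2} {z : Cn 2} (hz : z a ≠ 0) :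
    psi z = (ch a).symm !₂[z a, z a.rev / z a] := by
  have h : z ≠ 0 := fun h => hz (by simp [h])
  have hdir : z a • dir a (z a.rev / z a) = z := by
    apply ext_rev a
    · simp
    · simp [mul_div_cancel₀ _ hz]
  rw [psi, dif_neg h]
  apply Subtype.ext
  change (z, Projectivization.mk ℂ z h) = (z a • dir a (z a.rev / z a),
    Projectivization.mk ℂ (dir a (z a.rev / z a)) (dir_ne_zero _ _))
  rw [Prod.mk.injEq]
  refine ⟨hdir.symm, ?_⟩
  rw [Projectivization.mk_eq_mk_iff']
  exact ⟨z a, hdir⟩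

lemma psi_mem_source {a : Fin 2} {z : Cn 2} (hz : z a ≠ 0) : psi z ∈ (ch a).source := by
  rw [psi_eq_ch_symm hz]
  exact ch_symm_mem a _

lemma ch_psi {a : Fin 2} {z : Cn 2} (hz : z a ≠ 0) : ch a (psi z) = !₂[z a, z a.rev / z a] := by
  rw [psi_eq_ch_symm hz, ch_right_inv]

lemma psi_blowDown {p : BlowUp} (hp : p ∈ offE) : psi (blowDown p) = p := by
  obtain ⟨a, ha⟩ := exists_chartAt_eq p
  have hs : p ∈ (ch a).source := ha ▸ mem_chart_source (Cn 2) p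
  rw [← (ch a).left_inv hs] at hp ⊢
  have h0 : ch a p 0 ≠ 0 := (ch_symm_mem_offE a _).1 hp
  have hz : blowDown ((ch a).symm (ch a p)) a = ch a p 0 := by
    rw [blowDown_ch_symm]
    simp
  have hz' : blowDown ((ch a).symm (ch a p)) a.rev = ch a p 0 * ch a p 1 := by
    rw [blowDown_ch_symm]
    simp
  rw [psi_eq_ch_symm (a := a) (by rwa [hz]), hz, hz']
  congr 1
  ext i
  fin_cases i
  · rfl
  · exact mul_div_cancel_left₀ _ h0

lemma exists_coord_ne {z : Cn 2} (hz : z ≠ 0) : ∃ a : Fin 2, z a ≠ 0 := by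
  by_contra h
  push Not at h
  exact hz (by ext i; exact h i)

lemma contMDiffAt_psi {z : Cn 2} (hz : z ≠ 0) : ContMDiffAt 𝓘(ℝ, Cn 2) 𝓘(ℝ, Cn 2) ∞ psi z := by
  obtain ⟨a, ha⟩ := exists_coord_ne hz
  have h1 : ContDiffAt ℝ ∞ (fun z : Cn 2 => (!₂[z a, z a.rev / z a] : Cn 2)) z := by
    refine (contDiffAt_piLp 2).2 fun i => ?_
    fin_cases i
    · exact (contDiff_coord a).contDiffAt
    · simp only [div_eq_mul_inv]
      exact (contDiff_coord a.rev).contDiffAt.mul ((contDiff_coord a).contDiffAt.inv ha)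
  refine ((((contMDiff_ch_symm a).of_le le_top).contMDiffAt).comp z
    h1.contMDiffAt).congr_of_eventuallyEq ?_
  filter_upwards [(continuous_coord a).continuousAt.eventually_ne ha] with w hw
  exact psi_eq_ch_symm hw

/-- The difference of the Simanca metric and the Euclidean one off the exceptional divisor. -/
def eta (V W z : Cn 2) : ℝ :=
  ((z 0 * V 1 - z 1 * V 0) * star (z 0 * W 1 - z 1 * W 0)).re * ((‖z‖ ^ 2) ^ 2)⁻¹

lemma wedge_rev (a : Fin 2) (z V W : Cn 2) :
    (z 0 * V 1 - z 1 * V 0) * star (z 0 * W 1 - z 1 * W 0)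
      = (z a * V a.rev - z a.rev * V a) * star (z a * W a.rev - z a.rev * W a) := by
  fin_cases a
  · rfl
  · simp [Fin.rev]
    ring

lemma inner_rev (a : Fin 2) (V W : Cn 2) :
    (inner ℂ V W).re = (V a * star (W a) + V a.rev * star (W a.rev)).re := by
  rw [← Complex.conj_re, inner_conj_symm, PiLp.inner_apply, Fin.sum_univ_two]
  fin_cases a
  · simp [Fin.rev]
  · simp [Fin.rev]
    ring

lemma fderiv_blowDown_psi (z V : Cn 2) : fderiv ℝ (blowDown ∘ psi) z V = V := by
  rw [show blowDown ∘ psi = id from funext blowDown_psi, fderiv_id]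
  rfl

/-- The flat part of `form` is the Euclidean metric in `z`. With `v = z_b / z_a` one has `dv = (z_a
dz_b - z_b dz_a) / z_a²` and `1 / (1 + |v|²) = |z_a|² / |z|²`, so the Fubini-Study term becomes `|z
∧ dz|² / |z|⁴`. -/
lemma riemannian_psi {z : Cn 2} (hz : z ≠ 0) (V W : Cn 2) :
    simanca.riemannian (psi z) (mfderiv 𝓘(ℝ, Cn 2) 𝓘(ℝ, Cn 2) psi z V)
      (mfderiv 𝓘(ℝ, Cn 2) 𝓘(ℝ, Cn 2) psi z W) = (inner ℂ V W).re + eta V W z := by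
  obtain ⟨a, ha⟩ := exists_coord_ne hz
  have hd := (contMDiffAt_psi hz).mdifferentiableAt (by simp)
  have hs := psi_mem_source ha
  refine (riemannian_mfderiv hd hs V W).trans ?_
  obtain ⟨hV0, hV1⟩ := fderiv_blowDown_comp hd hs V
  obtain ⟨hW0, hW1⟩ := fderiv_blowDown_comp hd hs W
  rw [fderiv_blowDown_psi] at hV0 hV1 hW0 hW1
  have hform : ∀ y V' W' : Cn 2, form y V' W' = V' 0 * star (W' 0)
      + (y 1 * V' 0 + y 0 * V' 1) * star (y 1 * W' 0 + y 0 * W' 1)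
      + ca y ^ 2 * (V' 1 * star (W' 1)) := fun _ _ _ => rfl
  rw [hform, ← hV1, ← hW1, ← hV0, ← hW0, Complex.add_re, inner_rev a, eta, wedge_rev a]
  congr 1
  rw [ch_psi ha, ← hV0] at hV1
  rw [ch_psi ha, ← hW0] at hW1
  have eV : fderiv ℝ (ch a ∘ psi) z V 1 = (z a * V a.rev - z a.rev * V a) / z a ^ 2 := by
    rw [hV1]
    simp
    field_simp
    ring
  have eW : fderiv ℝ (ch a ∘ psi) z W 1 = (z a * W a.rev - z a.rev * W a) / z a ^ 2 := by
    rw [hW1]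
    simp
    field_simp
    ring
  have hn : ‖z a‖ ≠ 0 := norm_ne_zero_iff.2 ha
  have eca : ca (ch a (psi z)) = ((‖z a‖ ^ 2 / ‖z‖ ^ 2 : ℝ) : ℂ) := by
    rw [ca_eq_ofReal, ch_psi ha, norm_sq_eq_rev a z]
    congr 1
    simp
    field_simp
  have hsa : star (z a) ≠ 0 := star_ne_zero.2 ha
  have key : ca (ch a (psi z)) ^ 2 * (fderiv ℝ (ch a ∘ psi) z V 1 *
      star (fderiv ℝ (ch a ∘ psi) z W 1))
      = (z a * V a.rev - z a.rev * V a) * star (z a * W a.rev - z a.rev * W a)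
        * (((‖z‖ ^ 2) ^ 2)⁻¹ : ℝ) := by
    rw [eV, eW, eca, star_div₀, star_pow, Complex.ofReal_div, ofReal_norm_sq (z a)]
    push_cast
    field_simp
  rw [key, Complex.re_mul_ofReal]

lemma contDiffAt_eta (V W : Cn 2) {z : Cn 2} (hz : z ≠ 0) : ContDiffAt ℝ ∞ (eta V W) z := by
  have h1 : ∀ U : Cn 2, ContDiff ℝ ∞ fun z : Cn 2 => z 0 * U 1 - z 1 * U 0 := fun U =>
    ((contDiff_coord 0).mul contDiff_const).sub ((contDiff_coord 1).mul contDiff_const)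
  have h2 : ContDiff ℝ ∞ fun z : Cn 2 => star (z 0 * W 1 - z 1 * W 0) :=
    (starL' ℝ : ℂ ≃L[ℝ] ℂ).contDiff.comp (h1 W)
  have h3 : ContDiff ℝ ∞ fun z : Cn 2 =>
      ((z 0 * V 1 - z 1 * V 0) * star (z 0 * W 1 - z 1 * W 0)).re :=
    Complex.reCLM.contDiff.comp ((h1 V).mul h2)
  have h4 : ContDiffAt ℝ ∞ (fun z : Cn 2 => (‖z‖ ^ 2) ^ 2) z := (contDiffAt_id.norm_sq ℝ).pow 2
  exact h3.contDiffAt.mul (h4.inv (by positivity))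

lemma eta_homogeneous (V W : Cn 2) {t : ℝ} (ht : 0 < t) (z : Cn 2) :
    eta V W z = t ^ 2 * eta V W (t • z) := by
  have e : (((t • z) 0 * V 1 - (t • z) 1 * V 0) * star ((t • z) 0 * W 1 - (t • z) 1 * W 0))
      = ((t ^ 2 : ℝ) : ℂ) * ((z 0 * V 1 - z 1 * V 0) * star (z 0 * W 1 - z 1 * W 0)) := by
    simp
    ring
  rw [eta, eta, e, Complex.re_ofReal_mul, norm_smul, Real.norm_of_nonneg ht.le]
  field_simp

/-- The complement is the preimage of the closed unit ball under the blow-down; it is covered by the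
part `|v| ≤ 1` of each chart, where `K` is compact. -/
lemma isCompact_compl_image_psi : IsCompact (psi '' {x | 1 < ‖x‖})ᶜ := by
  let K : Set (Cn 2) := {y | ‖y 1‖ ≤ 1 ∧ ‖y 0‖ ^ 2 * (1 + ‖y 1‖ ^ 2) ≤ 1}
  have hK : IsCompact K := by
    refine Metric.isCompact_of_isClosed_isBounded ?_ ?_
    · have h0 := (continuous_coord 0).norm
      have h1 := (continuous_coord 1).norm
      exact (isClosed_le h1 continuous_const).inter
        (isClosed_le ((h0.pow 2).mul (continuous_const.add (h1.pow 2))) continuous_const)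
    · refine (Metric.isBounded_closedBall (x := (0 : Cn 2)) (r := 2)).subset fun y hy => ?_
      rw [mem_closedBall_zero_iff]
      refine le_of_sq_le_sq ?_ (by norm_num)
      rw [EuclideanSpace.norm_sq_eq, Fin.sum_univ_two]
      obtain ⟨h1, h2⟩ := hy
      have e1 := pow_le_pow_left₀ (norm_nonneg _) h1 2
      have e2 : 0 ≤ ‖y 0‖ ^ 2 * ‖y 1‖ ^ 2 := by positivity
      nlinarith
  have hEq : (psi '' {x | 1 < ‖x‖})ᶜ = (ch 0).symm '' K ∪ (ch 1).symm '' K := by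
    ext p
    have h1 : p ∈ (psi '' {x | 1 < ‖x‖})ᶜ ↔ ‖blowDown p‖ ^ 2 ≤ 1 := by
      rw [sq_le_one_iff₀ (norm_nonneg _)]
      constructor
      · intro h
        by_contra hlt
        push Not at hlt
        refine h ⟨blowDown p, hlt, psi_blowDown fun h0 => ?_⟩
        rw [h0, norm_zero] at hlt
        linarith
      · rintro h ⟨x, hx, rfl⟩
        rw [blowDown_psi] at h
        exact absurd h (not_le.2 hx)
    rw [h1]
    constructor
    · intro h
      obtain ⟨a, ha, hle⟩ := exists_ch_slope_le_one p
      have hmem : p ∈ (ch a).symm '' K := by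
        refine ⟨ch a p, ⟨hle, ?_⟩, (ch a).left_inv ha⟩
        rwa [← norm_sq_blowDown_ch_symm a, (ch a).left_inv ha]
      fin_cases a
      · exact Or.inl hmem
      · exact Or.inr hmem
    · rintro (⟨y, hy, rfl⟩ | ⟨y, hy, rfl⟩) <;>
      · rw [norm_sq_blowDown_ch_symm]
        exact hy.2
  rw [hEq]
  exact (hK.image (contMDiff_ch_symm 0).continuous).union
    (hK.image (contMDiff_ch_symm 1).continuous)

lemma isALE_simanca : simanca.IsALEOfOrder 2 := by
  have hne : ∀ x : Cn 2, 1 < ‖x‖ → x ≠ 0 := fun x hx h0 => by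
    rw [h0, norm_zero] at hx
    linarith
  -- The blow-down is injective off the exceptional divisor, so no quotient is needed; the radius
  -- `1` is arbitrary.
  refine ⟨⊥, 1, psi, inferInstance, one_pos,
    fun x hx => (contMDiffAt_psi (hne x hx)).contMDiffWithinAt, fun x hx => ?_, fun x y _ _ => ?_,
    isCompact_compl_image_psi, fun V W k => ?_⟩
  · have hd := (contMDiffAt_psi (hne x hx)).mdifferentiableAt (by simp)
    -- A vector killed by the derivative of `psi` has length zero upstairs, hence also after the
    -- blow-down, which returns `v` itself.
    have key : ∀ v : Cn 2, (mfderiv 𝓘(ℝ, Cn 2) 𝓘(ℝ, Cn 2) psi x v : Cn 2) = 0 → v = 0 := ?_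
    · exact (injective_iff_map_eq_zero (mfderiv 𝓘(ℝ, Cn 2) 𝓘(ℝ, Cn 2) psi x)).2 key
    intro v hv
    have h := (congrArg (fun w : Cn 2 => ‖w‖ ^ 2) (fderiv_blowDown_psi x v)).symm.trans_le
      (norm_sq_fderiv_blowDown_le hd v)
    have h0 : simanca.riemannian (psi x) (mfderiv 𝓘(ℝ, Cn 2) 𝓘(ℝ, Cn 2) psi x v)
        (mfderiv 𝓘(ℝ, Cn 2) 𝓘(ℝ, Cn 2) psi x v) = 0 := by
      exact (congrArg (fun w : Cn 2 => simanca.riemannian (psi x) w w) hv).trans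
        (congrArg Complex.re ((simanca.herm (psi x)).map_zero₂ _))
    rw [h0] at h
    have h' : ‖v‖ = 0 := pow_eq_zero_iff (two_ne_zero) |>.1 (le_antisymm h (sq_nonneg _))
    exact norm_eq_zero.1 h'
  · simp only [Subgroup.mem_bot, exists_eq_left]
    constructor
    · intro h
      have := congrArg blowDown h
      rwa [blowDown_psi, blowDown_psi] at this
    · intro h
      exact congrArg psi h
  · obtain ⟨C, hC⟩ := exists_norm_iteratedFDeriv_le_of_homogeneous 2
      (fun x hx => contDiffAt_eta V W hx) (fun t ht x => eta_homogeneous V W ht x) k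
    refine ⟨C, fun x hx => ?_⟩
    have hx0 := hne x hx
    have hev : (fun y => simanca.riemannian (psi y) (mfderiv 𝓘(ℝ, Cn 2) 𝓘(ℝ, Cn 2) psi y V)
        (mfderiv 𝓘(ℝ, Cn 2) 𝓘(ℝ, Cn 2) psi y W) - (inner ℂ V W).re) =ᶠ[nhds x] eta V W := by
      filter_upwards [isOpen_ne.mem_nhds hx0] with y hy
      rw [riemannian_psi hy, add_sub_cancel_left]
    have h1 := (hev.filter_mono nhdsWithin_le_nhds).iteratedFDerivWithin_eq (𝕜 := ℝ) (s := Set.univ)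
      hev.eq_of_nhds k
    rw [iteratedFDerivWithin_univ, iteratedFDerivWithin_univ] at h1
    refine (congrArg norm h1).trans_le ((hC x hx0).trans_eq ?_)
    have hpos : 0 < ‖x‖ := norm_pos_iff.2 hx0
    rw [inv_pow, ← Real.rpow_natCast, ← Real.rpow_neg hpos.le]
    congr 2
    push_cast
    ring

end BlowUp

/-! ### Coherent states in the Bargmann-Fock space -/

namespace Fock
open KahlerMetric

/-- The normalized monomial `z ^ m / √m!`. -/
def mono (m : ℕ) (z : ℂ) : ℂ := z ^ m / (Real.sqrt m.factorial : ℂ)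

/-- The derivative of the normalized monomial. -/
def monoD (m : ℕ) (z : ℂ) : ℂ := m * z ^ (m - 1) / (Real.sqrt m.factorial : ℂ)

/-- A bound for the normalized monomial and its derivative on the ball of radius `R`. -/
def bound (R : ℝ) (m : ℕ) : ℝ := (2 * R) ^ m / Real.sqrt m.factorial

lemma hasDerivAt_mono (m : ℕ) (z : ℂ) : HasDerivAt (mono m) (monoD m z) z :=
  (hasDerivAt_pow m z).div_const _

lemma norm_sqrt_factorial (m : ℕ) :
    ‖(Real.sqrt m.factorial : ℂ)‖ = Real.sqrt m.factorial := by
  rw [Complex.norm_real, Real.norm_of_nonneg (Real.sqrt_nonneg _)]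

lemma norm_mono_sq (m : ℕ) (z : ℂ) : ‖mono m z‖ ^ 2 = (‖z‖ ^ 2) ^ m / m.factorial := by
  rw [mono, norm_div, norm_sqrt_factorial, div_pow, Real.sq_sqrt (by positivity), norm_pow,
    ← pow_mul, ← pow_mul, mul_comm]

lemma bound_nonneg {R : ℝ} (hR : 1 ≤ R) (m : ℕ) : 0 ≤ bound R m := by
  unfold bound
  positivity

lemma norm_mono_le {R : ℝ} (hR : 1 ≤ R) {z : ℂ} (hz : ‖z‖ ≤ R) (m : ℕ) :
    ‖mono m z‖ ≤ bound R m := by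
  rw [mono, bound, norm_div, norm_sqrt_factorial, norm_pow]
  gcongr
  linarith

/-- The factor `2 ^ m` of `bound` absorbs `m`, and `R ≥ 1` allows the exponent `m - 1` to be raised
to `m`, also when `m = 0`. -/
lemma norm_monoD_le {R : ℝ} (hR : 1 ≤ R) {z : ℂ} (hz : ‖z‖ ≤ R) (m : ℕ) :
    ‖monoD m z‖ ≤ bound R m := by
  rw [monoD, bound, norm_div, norm_sqrt_factorial, norm_mul, norm_pow, mul_pow]
  have h1 : ‖(m : ℂ)‖ ≤ 2 ^ m := by
    rw [Complex.norm_natCast]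
    exact_mod_cast m.lt_two_pow_self.le
  have h2 : ‖z‖ ^ (m - 1) ≤ R ^ m :=
    (pow_le_pow_left₀ (norm_nonneg z) hz _).trans (pow_le_pow_right₀ hR (Nat.sub_le m 1))
  gcongr

/-- The ratio of consecutive terms is `2 R / √(m + 1)`, which tends to `0`. -/
lemma summable_bound {R : ℝ} (hR : 1 ≤ R) : Summable (bound R) := by
  have hpos : ∀ m, 0 < bound R m := fun m => by unfold bound; positivity
  refine summable_of_ratio_test_tendsto_lt_one zero_lt_one
    (Filter.Eventually.of_forall fun m => (hpos m).ne') ?_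
  have h : ∀ m : ℕ, ‖bound R (m + 1)‖ / ‖bound R m‖ = 2 * R / Real.sqrt ((m + 1 : ℕ) : ℝ) := by
    intro m
    rw [Real.norm_of_nonneg (hpos _).le, Real.norm_of_nonneg (hpos _).le, bound, bound,
      Nat.factorial_succ, Nat.cast_mul, Real.sqrt_mul (by positivity), pow_succ]
    have h1 : 0 < Real.sqrt ((m + 1 : ℕ) : ℝ) := by positivity
    have h2 : 0 < Real.sqrt (m.factorial : ℝ) := by positivity
    field_simp
  simp only [h]
  exact tendsto_const_nhds.div_atTop (Real.tendsto_sqrt_atTop.comp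
    (tendsto_natCast_atTop_atTop.comp (Filter.tendsto_add_atTop_nat 1)))

/-- An enumeration of the products of a basis vector of `ℂ²` and a monomial in two variables. -/
def enum : ℕ ≃ Fin 2 × ℕ × ℕ := (nonempty_equiv_of_countable (α := ℕ) (β := Fin 2 × ℕ × ℕ)).some


/-- The coefficients of `w ⊗ e(z)`, where `e(z)` is the coherent state at `z`. -/
def coord (w z : Cn 2) (n : ℕ) : ℂ :=
  w (enum n).1 * (mono (enum n).2.1 (z 0) * mono (enum n).2.2 (z 1))

lemma hasSum_norm_mono_sq (z : ℂ) : HasSum (fun m => ‖mono m z‖ ^ 2) (Real.exp (‖z‖ ^ 2)) := by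
  simp only [norm_mono_sq]
  rw [Real.exp_eq_exp_ℝ]
  exact NormedSpace.expSeries_div_hasSum_exp (‖z‖ ^ 2)

/-- The sum factors along `Fin 2 × ℕ × ℕ`: the first index gives `‖w‖²`, and each of the others an
exponential series. -/
lemma hasSum_norm_coord_sq (w z : Cn 2) :
    HasSum (fun n => ‖coord w z n‖ ^ 2) (‖w‖ ^ 2 * Real.exp (‖z‖ ^ 2)) := by
  have h0 := hasSum_norm_mono_sq (z 0)
  have h1 := hasSum_norm_mono_sq (z 1)
  have h01 := h0.mul h1 (h0.summable.mul_of_nonneg h1.summable (fun _ => sq_nonneg _)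
    fun _ => sq_nonneg _)
  have hw := hasSum_fintype fun i : Fin 2 => ‖w i‖ ^ 2
  have h := hw.mul h01 (hw.summable.mul_of_nonneg h01.summable (fun _ => sq_nonneg _)
    fun _ => by positivity)
  rw [← EuclideanSpace.norm_sq_eq, ← Real.exp_add, ← Fin.sum_univ_two (fun i => ‖z i‖ ^ 2),
    ← EuclideanSpace.norm_sq_eq] at h
  refine (enum.hasSum_iff.2 h).congr_fun ?_
  intro n
  simp [coord, mul_pow]

/-- The vector `w ⊗ e(z)`, where `e(z)` is the coherent state at `z`. -/
def state (w z : Cn 2) : EllTwo :=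
  ⟨coord w z, memℓp_gen (by simpa using (hasSum_norm_coord_sq w z).summable)⟩

lemma norm_sq_state (w z : Cn 2) : ‖state w z‖ ^ 2 = ‖w‖ ^ 2 * Real.exp (‖z‖ ^ 2) := by
  have h := lp.norm_rpow_eq_tsum (p := 2) (by simp) (state w z)
  simp only [ENNReal.toReal_ofNat, Real.rpow_ofNat] at h
  rw [h]
  exact (hasSum_norm_coord_sq w z).tsum_eq

lemma state_ne_zero {w : Cn 2} (hw : w ≠ 0) (z : Cn 2) : state w z ≠ 0 := by
  intro h
  have h' := norm_sq_state w z
  rw [h, norm_zero, zero_pow two_ne_zero] at h'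
  have hpos : 0 < ‖w‖ ^ 2 * Real.exp (‖z‖ ^ 2) := by positivity
  exact hpos.ne h'

lemma state_smul (c : ℂ) (w z : Cn 2) : state (c • w) z = c • state w z := by
  ext n
  simp [state, coord, mul_assoc]

/-- Linearity in `w` reduces joint holomorphy in `(w, z)` to holomorphy in `z` for fixed basis
vectors. -/
lemma state_eq_add (w z : Cn 2) :
    state w z = w 0 • state (EuclideanSpace.single 0 1) z
      + w 1 • state (EuclideanSpace.single 1 1) z := by
  ext n
  simp only [state, coord, lp.coeFn_add, lp.coeFn_smul, Pi.add_apply, Pi.smul_apply, smul_eq_mul]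
  generalize (enum n).1 = i
  fin_cases i <;> simp

/-- The expansion in the standard basis of `ℓ²` is differentiated term by term on a ball around the
origin, where the derivatives are dominated by a summable sequence. -/
lemma differentiable_state (w : Cn 2) : Differentiable ℂ (state w) := by
  intro z₀
  -- This radius puts `z₀` in the open ball and gives `1 ≤ R`, as the bounds on monomials require.
  set R : ℝ := ‖z₀‖ + 1
  have hR : 1 ≤ R := by simp [R]
  let prj (k : Fin 2) : Cn 2 →L[ℂ] ℂ := EuclideanSpace.proj k
  have hprj (k : Fin 2) : ‖prj k‖ ≤ 1 :=
    ContinuousLinearMap.opNorm_le_bound _ zero_le_one fun z => by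
      simpa [prj] using PiLp.norm_apply_le z k
  let D (n : ℕ) (z : Cn 2) : Cn 2 →L[ℂ] ℂ :=
    w (enum n).1 • (mono (enum n).2.1 (z 0) • (monoD (enum n).2.2 (z 1) • prj 1)
      + mono (enum n).2.2 (z 1) • (monoD (enum n).2.1 (z 0) • prj 0))
  have hD (n : ℕ) (z : Cn 2) : HasFDerivAt (fun z => coord w z n) (D n z) z := by
    have h (m : ℕ) (k : Fin 2) : HasFDerivAt (fun z : Cn 2 => mono m (z k))
        (monoD m (z k) • prj k) z :=
      HasDerivAt.comp_hasFDerivAt (f := prj k) z (hasDerivAt_mono m (z k)) (prj k).hasFDerivAt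
    exact ((h _ 0).mul (h _ 1)).const_mul _
  let s (n : ℕ) : ℂ →L[ℂ] EllTwo := lp.singleContinuousLinearMap ℂ (fun _ : ℕ => ℂ) 2 n
  have hs (n : ℕ) : ‖s n‖ ≤ 1 :=
    ContinuousLinearMap.opNorm_le_bound _ zero_le_one fun c => by
      rw [one_mul]
      exact (lp.norm_single (E := fun _ : ℕ => ℂ) (p := 2) (by norm_num) n c).le
  have hsum (z : Cn 2) : HasSum (fun n => s n (coord w z n)) (state w z) :=
    lp.hasSum_single (by simp) (state w z)
  have heq : state w = fun z => ∑' n, s n (coord w z n) := funext fun z => (hsum z).tsum_eq.symm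
  -- The factor `2` counts the two terms of the product rule in `D`.
  let u (n : ℕ) : ℝ :=
    ‖w (enum n).1‖ * (2 * (bound R (enum n).2.1 * bound R (enum n).2.2))
  have hu : Summable u := by
    have h01 := ((summable_bound hR).mul_of_nonneg (summable_bound hR) (bound_nonneg hR)
      (bound_nonneg hR)).mul_left 2
    have hw := (hasSum_fintype fun i : Fin 2 => ‖w i‖).summable
    have h := hw.mul_of_nonneg h01 (fun _ => norm_nonneg _) fun x =>
      mul_nonneg zero_le_two (mul_nonneg (bound_nonneg hR _) (bound_nonneg hR _))
    exact enum.summable_iff.2 h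
  rw [heq]
  refine (hasFDerivAt_tsum_of_isPreconnected (f' := fun n z => (s n).comp (D n z)) hu
    (Metric.isOpen_ball (x := (0 : Cn 2)) (ε := R)) (convex_ball _ _).isPreconnected
    (fun n z _ => (s n).hasFDerivAt.comp z (hD n z)) ?_ (x₀ := z₀) ?_ (hsum z₀).summable
    ?_).differentiableAt
  · intro n z hz
    have hz' (k : Fin 2) : ‖z k‖ ≤ R :=
      (PiLp.norm_apply_le z k).trans (mem_ball_zero_iff.1 hz).le
    have hterm (m l : ℕ) (i k : Fin 2) :
        ‖mono m (z i) • (monoD l (z k) • prj k)‖ ≤ bound R m * bound R l := by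
      rw [norm_smul, norm_smul]
      refine mul_le_mul (norm_mono_le hR (hz' i) m) ?_ (by positivity) (bound_nonneg hR m)
      exact (mul_le_of_le_one_right (norm_nonneg _) (hprj k)).trans (norm_monoD_le hR (hz' k) l)
    refine ((s n).opNorm_comp_le (D n z)).trans
      ((mul_le_of_le_one_left (norm_nonneg _) (hs n)).trans ?_)
    rw [norm_smul]
    refine mul_le_mul_of_nonneg_left ((norm_add_le _ _).trans ?_) (norm_nonneg _)
    have h1 := hterm (enum n).2.1 (enum n).2.2 0 1
    have h2 := hterm (enum n).2.2 (enum n).2.1 1 0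
    linarith
  · simp [R]
  · simp [R]

lemma differentiable_state_comp {w z : Cn 2 → Cn 2} (hw : Differentiable ℂ w)
    (hz : Differentiable ℂ z) : Differentiable ℂ fun y => state (w y) (z y) := by
  have h (k : Fin 2) : Differentiable ℂ fun y => w y k :=
    (EuclideanSpace.proj k : Cn 2 →L[ℂ] ℂ).differentiable.comp hw
  have heq : (fun y => state (w y) (z y)) = fun y =>
      w y 0 • state (EuclideanSpace.single 0 1) (z y)
        + w y 1 • state (EuclideanSpace.single 1 1) (z y) := funext fun y => state_eq_add _ _
  rw [heq]
  exact ((h 0).smul ((differentiable_state _).comp hz)).add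
    ((h 1).smul ((differentiable_state _).comp hz))

end Fock

namespace BlowUp
open Simanca KahlerMetric

/-! ### The Kähler immersion into the projective space of `ℓ²` -/

lemma mdifferentiableAt_of_ch {F : Type*} [NormedAddCommGroup F] [NormedSpace ℂ F]
    {f : BlowUp → F} {a : Fin 2} {p : BlowUp} (hp : p ∈ (ch a).source)
    (h : DifferentiableAt ℂ (f ∘ (ch a).symm) (ch a p)) :
    MDifferentiableAt 𝓘(ℂ, Cn 2) 𝓘(ℂ, F) f p := by
  have h1 : ContMDiffAt 𝓘(ℂ, Cn 2) 𝓘(ℂ, Cn 2) 1 (ch a) p :=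
    (contMDiffOn_of_mem_maximalAtlas
      (IsManifold.subset_maximalAtlas (ch_mem_atlas a))).contMDiffAt
      ((ch a).open_source.mem_nhds hp)
  have h2 := h.mdifferentiableAt.comp p (h1.mdifferentiableAt one_ne_zero)
  refine h2.congr_of_eventuallyEq ?_
  filter_upwards [(ch a).open_source.mem_nhds hp] with q hq
  simp only [Function.comp_apply, (ch a).left_inv hq]

lemma rep_ch_symm (a : Fin 2) (y : Cn 2) :
    (((ch a).symm y).1.2.rep a)⁻¹ • ((ch a).symm y).1.2.rep = dir a (y 1) := by
  obtain ⟨c, hc, h⟩ := rep_mk (dir a (y 1)) (dir_ne_zero _ _)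
  change ((Projectivization.mk ℂ (dir a (y 1)) (dir_ne_zero _ _)).rep a)⁻¹ •
    (Projectivization.mk ℂ (dir a (y 1)) (dir_ne_zero _ _)).rep = _
  rw [h, PiLp.smul_apply, dir_self, smul_eq_mul, mul_one, smul_smul, inv_mul_cancel₀ hc, one_smul]

/-- The map `(z, [w]) ↦ [w ⊗ e(z)]`, where `e(z)` is the coherent state at `z`. -/
def toProj (p : BlowUp) : ℙ ℂ EllTwo :=
  Projectivization.mk ℂ (Fock.state p.1.2.rep p.blowDown)
    (Fock.state_ne_zero p.1.2.rep_nonzero _)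

/-- The lift of `toProj` to `ℓ²` normalized in the chart `ch a`. -/
def lift (a : Fin 2) (p : BlowUp) : EllTwo :=
  Fock.state ((p.1.2.rep a)⁻¹ • p.1.2.rep) p.blowDown

lemma lift_ch_symm (a : Fin 2) (y : Cn 2) :
    lift a ((ch a).symm y) = Fock.state (dir a (y 1)) (blowDown ((ch a).symm y)) := by
  rw [lift, rep_ch_symm]

/-- The factor `‖dir a v‖² = 1 + |v|²` yields the logarithm in `pot`, and the coherent state yields
`|z|²`. -/
lemma log_norm_lift_ch_symm (a : Fin 2) (y : Cn 2) :
    Real.log (‖lift a ((ch a).symm y)‖ ^ 2) = pot y := by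
  rw [lift_ch_symm, Fock.norm_sq_state, norm_sq_dir, norm_sq_blowDown_ch_symm,
    Real.log_mul (one_add_norm_sq_ne y 1) (Real.exp_ne_zero _), Real.log_exp, pot, add_comm]

/-- In the other chart the direction vector has `a`-th coordinate `v`, so normalizing that
coordinate to `1` divides the squared norm by `|v|²`. -/
lemma log_norm_lift_ch_rev_symm {a : Fin 2} {y : Cn 2} (hy : y 1 ≠ 0) :
    Real.log (‖lift a ((ch a.rev).symm y)‖ ^ 2) = pot y + -1 * Real.log (‖y 1‖ ^ 2) := by
  have hmem : (ch a.rev).symm y ∈ (ch a).source := by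
    simpa using (ch_symm_mem_rev a.rev y).2 hy
  have h1 : ch a ((ch a.rev).symm y) = !₂[y 0 * y 1, (y 1)⁻¹] := by
    simpa using ch_rev_symm a.rev y
  rw [← (ch a).left_inv hmem, log_norm_lift_ch_symm, h1, pot, pot]
  have h2 : ‖y 1‖ ^ 2 ≠ 0 := by positivity
  have h3 : 1 + ‖(y 1)⁻¹‖ ^ 2 = (1 + ‖y 1‖ ^ 2) / ‖y 1‖ ^ 2 := by
    rw [norm_inv]
    field_simp
    ring
  simp only [Matrix.cons_val_zero, Matrix.cons_val_one]
  rw [h3, Real.log_div (one_add_norm_sq_ne y 1) h2, norm_mul]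
  field_simp
  ring

/-- A potential must be tested in both charts: in `ch a` it is `pot`, and in the other chart the
extra term `-log |v|²` is pluriharmonic by `ddbar_pot_add`. -/
lemma isPotentialOn_lift (a : Fin 2) :
    simanca.IsPotentialOn (fun p => Real.log (‖lift a p‖ ^ 2)) (ch a).source := by
  constructor
  · intro p hp
    refine (contMDiffAt_of_ch hp ?_).contMDiffWithinAt
    have h : (fun p => Real.log (‖lift a p‖ ^ 2)) ∘ (ch a).symm = pot :=
      funext (log_norm_lift_ch_symm a)
    rw [h]
    exact contDiff_pot.contDiffAt
  · intro e he y _ hy i j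
    obtain ⟨b, rfl⟩ := (mem_atlas_iff e).1 he
    rw [simanca_coeff]
    obtain rfl | hb := eq_or_eq_rev b a
    · rw [← ddbar_pot]
      exact ddbar_congr (.of_forall fun y => (log_norm_lift_ch_symm a y).symm) i j
    · obtain rfl : b = a.rev := by rw [hb, Fin.rev_rev]
      have hy1 : y 1 ≠ 0 := by
        rw [← ch_symm_mem_rev a.rev y, Fin.rev_rev]
        exact hy
      rw [← ddbar_pot_add (-1) 1 i j hy1]
      refine ddbar_congr ?_ i j
      filter_upwards [(continuous_coord 1).continuousAt.eventually_ne hy1] with z hz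
      exact (log_norm_lift_ch_rev_symm hz).symm

lemma isProjectivelyInduced_simanca : simanca.IsProjectivelyInduced := by
  refine ⟨toProj, fun p => ?_⟩
  obtain ⟨a, ha⟩ := exists_chartAt_eq p
  refine ⟨(ch a).source, (ch a).open_source, ha ▸ mem_chart_source (Cn 2) p, lift a, ?_, ?_,
    isPotentialOn_lift a⟩
  · intro q hq
    refine (mdifferentiableAt_of_ch hq ?_).mdifferentiableWithinAt
    have h : lift a ∘ (ch a).symm =
        fun y => Fock.state (dir a (y 1)) (blowDown ((ch a).symm y)) := funext (lift_ch_symm a)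
    rw [h]
    refine Fock.differentiable_state_comp ?_ ?_ _
    · exact (contDiff_euclidean.2 (contDiff_dir a)).differentiable (by simp)
    · exact (contDiff_blowDown_ch_symm a).differentiable (by simp)
  · intro q hq
    have hne : lift a q ≠ 0 :=
      Fock.state_ne_zero (smul_ne_zero (inv_ne_zero hq) q.1.2.rep_nonzero) _
    refine ⟨hne, ?_⟩
    rw [toProj, Projectivization.mk_eq_mk_iff']
    exact ⟨q.1.2.rep a, by rw [lift, ← Fock.state_smul, smul_smul, mul_inv_cancel₀ hq, one_smul]⟩

end BlowUp

end

theorem theorem1p3 :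
    (∃! g : KahlerMetric 2 BlowUp, BlowUp.IsSimanca g) ∧
    ∀ g : KahlerMetric 2 BlowUp, BlowUp.IsSimanca g →
      g.IsComplete ∧ g.IsALEOfOrder 2 ∧ BlowUp.IsRadial g ∧ g.IsProjectivelyInduced ∧
      g.IsScalarFlat ∧ ¬ g.IsRicciFlat ∧ ∀ x, g.a3 x = 0 := by
  refine ⟨⟨BlowUp.simanca, BlowUp.isSimanca_simanca, fun g hg => hg.eq_simanca⟩, fun g hg => ?_⟩
  rw [hg.eq_simanca]
  exact ⟨BlowUp.isComplete_simanca, BlowUp.isALE_simanca, BlowUp.isRadial_simanca,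
    BlowUp.isProjectivelyInduced_simanca, BlowUp.isScalarFlat_simanca,
    BlowUp.not_isRicciFlat_simanca, BlowUp.a3_simanca⟩
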